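/- Setup. For $n\ge 1$, a mask $M$ is a subset of $\binom{[n]}{2}$. Let $G(n,1/2)$ be the uniform distribution on $\{+1,-1\}^{\binom{[n]}{2}}$. For $k\le n$, let $G(n,1/2,k)$ be the distribution on $\{+1,-1\}^{\binom{[n]}{2}}$ obtained by choosing a uniformly random $k$-element set $K\subseteq[n]$, setting the coordinates of all pairs inside $K$ to $+1$, and choosing all other coordinates independently and uniformly from $\{+1,-1\}$. Let $G(n,M)$ and $G(n,k,M)$ denote the marginals of $G(n,1/2)$ and $G(n,1/2,k)$ on the coordinates in $M$. A sequence of real polynomials $f=f_n$ weakly (respectively strongly) separates two sequences of distributions $\mathbb P=\mathbb P_n$ and $\mathbb Q=\mathbb Q_n$ if $\mathbb E_{\mathbb P}[f]\ne\mathbb E_{\mathbb Q}[f]$ for all sufficiently large $n$ and, as $n\to\infty$, $$\bigl(\max\{\mathrm{Var}_{\mathbb P}(f),\mathrm{Var}_{\mathbb Q}(f)\}\bigr)^{1/2}=O\bigl(\bigl|\mathbb E_{\mathbb P}[f]-\mathbb E_{\mathbb Q}[f]\bigr|\bigr)\qquad\text{(respectively } o\bigl(\bigl|\mathbb E_{\mathbb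 P}[f]-\mathbb E_{\mathbb Q}[f]\bigr|\bigr)\text{)}.$$ Theorem. Fix constants $0<\delta<1/2$ and $0<\gamma<2$. (a) If $\gamma<3(1/2-\delta)$, then for every sequence of integers $k=k_n=\Theta(n^{1/2+\delta})$, every sequence of masks $M=M_n\subseteq\binom{[n]}{2}$ with $|M|=O(n^\gamma)$, and every sequence of polynomials $f=f_n$ in the variables $(Y_e)_{e\in M}$ of degree $o(\log^2 n)$, the sequence $f$ does not weakly separate $G(n,k,M)$ and $G(n,M)$. (b) If $\gamma>3(1/2-\delta)$, then there is a constant $C=C(\gamma,\delta)$ such that for every sequence of integers $k=k_n=\Theta(n^{1/2+\delta})$ there are disjoint sets $A=A_n$, $B=B_n\subseteq[n]$ such that the rectangular mask $M=\{\{a,b\}: a\in A,\ b\in B\}$ satisfies $|M|=O(n^\gamma)$, and a sequence of polynomials $f=f_n$ in the variables $(Y_e)_{e\in M}$ of degree at most $C$ that strongly separates $G(n,k,M)$ and $G(n,M)$. -/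

import Mathlib

open Filter Asymptotics MeasureTheory ProbabilityTheory
open scoped ENNReal

noncomputable section

/-- Unordered pairs of distinct vertices in `[n]`: the coordinates of a graph. -/
abbrev VertexPair (n : ℕ) : Type := {e : Sym2 (Fin n) // ¬ e.IsDiag}

/-- A mask over `[n]`: a set of unordered pairs of distinct vertices. -/
abbrev Mask (n : ℕ) : Type := Finset (VertexPair n)

/-- The uniform distribution on `{+1, -1}`, as a measure on `ℝ`. -/
def signLaw : Measure ℝ :=
  (2 : ℝ≥0∞)⁻¹ • (Measure.dirac (1 : ℝ) + Measure.dirac (-1 : ℝ))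

/-- `G(n, 1/2)`: the coordinates are independent uniform signs; `+1` means that the edge is
present. -/
def erdosRenyi (n : ℕ) : Measure (VertexPair n → ℝ) :=
  Measure.pi fun _ => signLaw

/-- The planted law given the set `K` of clique vertices: the coordinates of the pairs inside `K`
are `+1` and the other ones are independent uniform signs. -/
def plantedGiven (n : ℕ) (K : Finset (Fin n)) : Measure (VertexPair n → ℝ) :=
  Measure.pi fun e => if ∀ v ∈ e.1, v ∈ K then Measure.dirac 1 else signLaw

/-- `G(n, 1/2, k)`: the mixture of the laws `plantedGiven n K` over a uniformly random `k`-element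
set `K` of vertices (meaningful for `k ≤ n`). -/
def plantedClique (n k : ℕ) : Measure (VertexPair n → ℝ) :=
  (n.choose k : ℝ≥0∞)⁻¹ •
    ∑ K ∈ Finset.powersetCard k (Finset.univ : Finset (Fin n)), plantedGiven n K

/-- `G(n, M)`: the marginal of `G(n, 1/2)` on the coordinates in `M`. -/
def maskedNull {n : ℕ} (M : Mask n) : Measure (M → ℝ) :=
  (erdosRenyi n).map (Finset.restrict M)

/-- `G(n, k, M)`: the marginal of `G(n, 1/2, k)` on the coordinates in `M`. -/
def maskedPlanted {n : ℕ} (k : ℕ) (M : Mask n) : Measure (M → ℝ) :=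
  (plantedClique n k).map (Finset.restrict M)

/-- The rectangular mask of all pairs with one vertex in `A` and the other one in `B`. -/
def rectMask {n : ℕ} (A B : Finset (Fin n)) : Mask n :=
  Finset.univ.filter fun e => ∃ a ∈ A, ∃ b ∈ B, e.1 = s(a, b)

/-- `|E_P f - E_Q f|`. -/
def meanGap {ι : Type} (P Q : Measure (ι → ℝ)) (f : MvPolynomial ι ℝ) : ℝ :=
  |(∫ y, MvPolynomial.eval y f ∂P) - ∫ y, MvPolynomial.eval y f ∂Q|

/-- `(max {Var_P f, Var_Q f})^{1/2}`. -/
def maxStd {ι : Type} (P Q : Measure (ι → ℝ)) (f : MvPolynomial ι ℝ) : ℝ :=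
  √(max (variance (fun y => MvPolynomial.eval y f) P) (variance (fun y => MvPolynomial.eval y f) Q))

/-- Weak separation. The means have to differ for all large `n`: otherwise constant polynomials
would qualify, through `0 = O(0)`. -/
def WeaklySeparates {ι : ℕ → Type} (P Q : ∀ n, Measure (ι n → ℝ))
    (f : ∀ n, MvPolynomial (ι n) ℝ) : Prop :=
  (∀ᶠ n in atTop, meanGap (P n) (Q n) (f n) ≠ 0) ∧
    (fun n => maxStd (P n) (Q n) (f n)) =O[atTop] fun n => meanGap (P n) (Q n) (f n)

/-- Strong separation. The means have to differ for all large `n`: otherwise constant polynomials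
would qualify, through `0 = o(0)`. -/
def StronglySeparates {ι : ℕ → Type} (P Q : ∀ n, Measure (ι n → ℝ))
    (f : ∀ n, MvPolynomial (ι n) ℝ) : Prop :=
  (∀ᶠ n in atTop, meanGap (P n) (Q n) (f n) ≠ 0) ∧
    (fun n => maxStd (P n) (Q n) (f n)) =o[atTop] fun n => meanGap (P n) (Q n) (f n)

end

/-! ### Sign measures -/

/-! Write p = k/n, of order n^(-ε) with ε = 1/2 - δ; the threshold for |M| is n^(3ε).

Below it, let γ = 3ε - 2η. At most 2|M|/T vertices have degree above T = n^(2ε-η) in M, and the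
clique avoids all of them with probability 1 - O(n^(-η)). Discarding the other cliques moves the
planted mean by o(1) planted standard deviations (`sq_sum_sub_le`). On sign vectors f is a
combination of squarefree monomials indexed by edge sets S; given K, such a monomial has mean 1 if K
contains the vertex set V(S), and 0 otherwise. By Cauchy–Schwarz and Parseval the remaining gap is
at most the null standard deviation times √B, where B sums p^(2|V(S)|) over the nonempty S with at
most deg f edges that avoid the high-degree vertices (`meanGap_le_of_avoid`). Two counts show that B
tends to 0. Since deg f = o(log² n), a vertex set V is spanned by at most n^(η/2) edge sets per
vertex of V, multiplicatively (`card_filter_span_le`). And V is encoded by a maximal matching and a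
set of neighbours of that matching; as degrees are at most T, the neighbours cost a constant factor
per matching edge (`sum_pow_card_span_le`). What is left is of order |M| p^4 n^η.

Above it, take a left side of r = n^(ε+η) vertices and t right blocks of s = n^(2ε+η) vertices, and
sum over all stars with a centre on the left and one leaf in each block. The planted mean is about r
s^t p^(t+1) and the null variance is r s^t. The planted second moment is governed by the overlaps of
two stars and is asymptotic to the squared mean as soon as sp², rp and rp²(sp²)^t tend to infinity;
the last holds for a constant t ≥ ε/η (`separation_blockPoly`, `tendsto_blockRatio`). -/

theorem integral_signLaw (g : ℝ → ℝ) : ∫ y, g y ∂signLaw = (g 1 + g (-1)) / 2 := by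
  rw [signLaw, integral_smul_measure, integral_add_measure (integrable_dirac (by simp))
    (integrable_dirac (by simp)), integral_dirac, integral_dirac]
  simp
  ring

instance : IsProbabilityMeasure signLaw := by
  constructor
  simp only [signLaw, Measure.smul_apply, Measure.add_apply, measure_univ, smul_eq_mul]
  rw [one_add_one_eq_two]
  exact ENNReal.inv_mul_cancel (by simp) (by simp)

theorem ae_signLaw_sq_eq_one : ∀ᵐ y ∂signLaw, y ^ 2 = 1 := by
  refine Measure.ae_smul_measure ?_ _
  rw [ae_add_measure_iff, ae_dirac_eq, ae_dirac_eq]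
  simp

/-- A monomial evaluated at a vector of signs. -/
theorem prod_pow_eq_prod_odd {ι : Type*} [Fintype ι] (d : ι → ℕ) {y : ι → ℝ}
    (hy : ∀ i, y i ^ 2 = 1) : ∏ i, y i ^ d i = ∏ i with Odd (d i), y i := by
  rw [Finset.prod_filter]
  refine Finset.prod_congr rfl fun i _ => ?_
  split_ifs with h
  · obtain ⟨m, hm⟩ := h
    rw [hm, pow_succ, pow_mul, hy, one_pow, one_mul]
  · obtain ⟨m, hm⟩ := Nat.not_odd_iff_even.1 h
    rw [hm, ← two_mul, pow_mul, hy, one_pow]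

/-- On sign vectors a polynomial of degree at most `D` is a combination of squarefree monomials of
degree at most `D`. -/
theorem MvPolynomial.exists_multilinear {ι : Type*} [Fintype ι] [DecidableEq ι]
    (f : MvPolynomial ι ℝ) :
    ∃ c : Finset ι → ℝ, (∀ S, f.totalDegree < S.card → c S = 0) ∧
      ∀ y : ι → ℝ, (∀ i, y i ^ 2 = 1) → eval y f = ∑ S, c S * ∏ i ∈ S, y i := by
  refine ⟨fun S => ∑ d ∈ f.support with ({i | Odd (d i)} : Finset ι) = S, coeff d f, ?_, ?_⟩
  · intro S hS
    refine Finset.sum_eq_zero fun d hd => ?_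
    rw [Finset.mem_filter] at hd
    exfalso
    have h1 : S.card ≤ d.sum fun _ e => e := by
      rw [← hd.2, Finset.card_eq_sum_ones, Finsupp.sum_fintype _ _ (by simp)]
      calc ∑ i with Odd (d i), 1 ≤ ∑ i with Odd (d i), d i :=
            Finset.sum_le_sum fun i hi => (Finset.mem_filter.1 hi).2.pos
        _ ≤ _ := Finset.sum_le_sum_of_subset (Finset.filter_subset _ _)
    exact absurd (h1.trans (le_totalDegree hd.1)) (not_le.2 hS)
  · intro y hy
    rw [eval_eq', ← Finset.sum_fiberwise f.support (fun d => ({i | Odd (d i)} : Finset ι))]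
    refine Finset.sum_congr rfl fun S _ => ?_
    rw [Finset.sum_mul]
    refine Finset.sum_congr rfl fun d hd => ?_
    rw [prod_pow_eq_prod_odd _ hy, (Finset.mem_filter.1 hd).2]

theorem memLp_eval {ι : Type*} [Fintype ι] {P : Measure (ι → ℝ)} [IsFiniteMeasure P]
    (hP : ∀ᵐ y ∂P, ∀ i, y i ^ 2 = 1) (f : MvPolynomial ι ℝ) (q : ℝ≥0∞) :
    MemLp (fun y => MvPolynomial.eval y f) q P := by
  classical
  obtain ⟨c, -, hc⟩ := f.exists_multilinear
  refine MemLp.of_bound (MvPolynomial.continuous_eval f).aestronglyMeasurable (∑ S, |c S|) ?_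
  filter_upwards [hP] with y hy
  rw [hc y hy]
  refine (norm_sum_le _ _).trans (Finset.sum_le_sum fun S _ => ?_)
  have : ∏ i ∈ S, |y i| = 1 := Finset.prod_eq_one fun i _ => by
    rcases sq_eq_sq_iff_eq_or_eq_neg.1 ((hy i).trans (one_pow 2).symm) with h | h <;> simp [h]
  rw [norm_mul, Real.norm_eq_abs, Real.norm_eq_abs, Finset.abs_prod, this, mul_one]

theorem variance_eval {ι : Type*} [Fintype ι] {P : Measure (ι → ℝ)} [IsProbabilityMeasure P]
    (hP : ∀ᵐ y ∂P, ∀ i, y i ^ 2 = 1) (f : MvPolynomial ι ℝ) :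
    variance (fun y => MvPolynomial.eval y f) P =
      (∫ y, MvPolynomial.eval y (f * f) ∂P) - (∫ y, MvPolynomial.eval y f ∂P) ^ 2 := by
  rw [variance_eq_sub (memLp_eval hP f 2)]
  simp [sq]

/-! ### The planted law given the clique -/

section Planted

variable {n : ℕ}

/-- Both ends of the pair lie in `K`. -/
def VertexPair.Inside (K : Finset (Fin n)) (e : VertexPair n) : Prop := ∀ v ∈ e.1, v ∈ K

instance isProbabilityMeasure_coord (K : Finset (Fin n)) (e : VertexPair n) :
    IsProbabilityMeasure (if ∀ v ∈ e.1, v ∈ K then Measure.dirac (1 : ℝ) else signLaw) := by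
  split_ifs <;> infer_instance

instance (K : Finset (Fin n)) : IsProbabilityMeasure (plantedGiven n K) := by
  rw [plantedGiven]; infer_instance

theorem VertexPair.not_inside_empty (e : VertexPair n) : ¬ e.Inside ∅ := by
  obtain ⟨⟨a, b⟩, h⟩ := e
  intro H
  simpa using H a (by simp)

/-- This makes every null moment the case K = ∅ of a planted moment, so one computation serves both
laws. -/
theorem erdosRenyi_eq_plantedGiven : erdosRenyi n = plantedGiven n ∅ := by
  rw [erdosRenyi, plantedGiven]
  congr 1
  ext1 e
  exact (if_neg e.not_inside_empty).symm

theorem ae_plantedGiven (K : Finset (Fin n)) : ∀ᵐ y ∂plantedGiven n K, ∀ e, y e ^ 2 = 1 := by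
  refine eventually_all.2 fun e => ?_
  refine Measure.tendsto_eval_ae_ae.eventually (p := fun y : ℝ => y ^ 2 = 1) ?_
  split_ifs
  · simp [ae_dirac_eq]
  · exact ae_signLaw_sq_eq_one

-- Common factors square to 1. Each remaining coordinate has mean 1 inside the clique and 0 outside,
-- and coordinates are independent given K.
open Classical in
theorem integral_prod_mul_prod (K : Finset (Fin n)) (S S' : Finset (VertexPair n)) :
    ∫ y, (∏ e ∈ S, y e) * ∏ e ∈ S', y e ∂plantedGiven n K =
      if ∀ e ∈ symmDiff S S', e.Inside K then 1 else 0 := by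
  have h : ∀ y : VertexPair n → ℝ, (∏ e ∈ S, y e) * ∏ e ∈ S', y e =
      ∏ e, y e ^ ((if e ∈ S then 1 else 0) + if e ∈ S' then 1 else 0) := by
    intro y
    simp only [pow_add, Finset.prod_mul_distrib, pow_ite, pow_one, pow_zero, Finset.prod_ite_mem,
      Finset.univ_inter]
  simp only [h]
  rw [plantedGiven, integral_fintype_prod_eq_prod
    (f := fun e (x : ℝ) => x ^ ((if e ∈ S then 1 else 0) + if e ∈ S' then 1 else 0))]
  have h2 : ∀ e : VertexPair n, (∫ x : ℝ, x ^ ((if e ∈ S then 1 else 0) + if e ∈ S' then 1 else 0)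
      ∂(if ∀ v ∈ e.1, v ∈ K then Measure.dirac (1 : ℝ) else signLaw)) =
      if e ∈ symmDiff S S' → e.Inside K then 1 else 0 := by
    intro e
    by_cases hK : ∀ v ∈ e.1, v ∈ K
    · have : e.Inside K := hK
      rw [if_pos hK, integral_dirac]
      simp [this]
    · have : ¬ e.Inside K := hK
      rw [if_neg hK, integral_signLaw]
      by_cases h1 : e ∈ S <;> by_cases h2 : e ∈ S' <;> simp [h1, h2, this, Finset.mem_symmDiff]
  rw [Finset.prod_congr rfl fun e _ => h2 e, Finset.prod_ite_zero]
  simp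

/-- The mean of `f` over the coordinates in `M` given that the clique is `K`. -/
noncomputable def cliqueMean (M : Mask n) (K : Finset (Fin n)) (f : MvPolynomial M ℝ) : ℝ :=
  ∫ y, MvPolynomial.eval (M.restrict y) f ∂plantedGiven n K

theorem ae_restrict_plantedGiven (M : Mask n) (K : Finset (Fin n)) :
    ∀ᵐ y ∂plantedGiven n K, ∀ e, M.restrict y e ^ 2 = 1 := by
  filter_upwards [ae_plantedGiven K] with y hy e using hy e

theorem measurableSet_sq_eq_one (ι : Type*) [Finite ι] :
    MeasurableSet {y : ι → ℝ | ∀ i, y i ^ 2 = 1} := by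
  have : IsClosed {y : ι → ℝ | ∀ i, y i ^ 2 = 1} := by
    simp only [Set.ofPred_forall]
    exact isClosed_iInter fun i => isClosed_eq (by fun_prop) continuous_const
  exact this.measurableSet

theorem ae_map_plantedGiven (M : Mask n) (K : Finset (Fin n)) :
    ∀ᵐ y ∂(plantedGiven n K).map M.restrict, ∀ e, y e ^ 2 = 1 :=
  (ae_map_iff M.measurable_restrict.aemeasurable (measurableSet_sq_eq_one _)).2
    (ae_restrict_plantedGiven M K)

instance (M : Mask n) (K : Finset (Fin n)) :
    IsProbabilityMeasure ((plantedGiven n K).map M.restrict) :=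
  Measure.isProbabilityMeasure_map M.measurable_restrict.aemeasurable

theorem integral_map_plantedGiven (M : Mask n) (K : Finset (Fin n)) (f : MvPolynomial M ℝ) :
    ∫ y, MvPolynomial.eval y f ∂(plantedGiven n K).map M.restrict = cliqueMean M K f :=
  integral_map M.measurable_restrict.aemeasurable
    (MvPolynomial.continuous_eval f).aestronglyMeasurable

theorem maskedNull_eq (M : Mask n) : maskedNull M = (plantedGiven n ∅).map M.restrict := by
  rw [maskedNull, erdosRenyi_eq_plantedGiven]

theorem maskedPlanted_eq (k : ℕ) (M : Mask n) :
    maskedPlanted k M = (n.choose k : ℝ≥0∞)⁻¹ •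
      ∑ K ∈ Finset.powersetCard k (Finset.univ : Finset (Fin n)),
        (plantedGiven n K).map M.restrict := by
  rw [maskedPlanted, plantedClique, Measure.map_smul]
  congr 1
  rw [← Measure.mapₗ_apply_of_measurable M.measurable_restrict, map_sum]
  exact Finset.sum_congr rfl fun K _ => Measure.mapₗ_apply_of_measurable M.measurable_restrict _

theorem isProbabilityMeasure_maskedPlanted {k : ℕ} (hk : k ≤ n) (M : Mask n) :
    IsProbabilityMeasure (maskedPlanted k M) := by
  constructor
  rw [maskedPlanted_eq]
  simp only [Measure.smul_apply, Measure.finsetSum_apply, measure_univ, smul_eq_mul,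
    Finset.sum_const, Finset.card_powersetCard, Finset.card_univ, Fintype.card_fin, nsmul_eq_mul,
    mul_one]
  exact ENNReal.inv_mul_cancel (by simpa using (Nat.choose_pos hk).ne') (by simp)

theorem ae_maskedPlanted (k : ℕ) (M : Mask n) : ∀ᵐ y ∂maskedPlanted k M, ∀ e, y e ^ 2 = 1 := by
  rw [maskedPlanted_eq]
  refine Measure.ae_smul_measure ?_ _
  rw [ae_iff, Measure.finsetSum_apply]
  exact Finset.sum_eq_zero fun K _ => ae_iff.1 (ae_map_plantedGiven M K)

/-- The average over all `k`-element sets. -/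
noncomputable def cliqueAvg (n k : ℕ) (g : Finset (Fin n) → ℝ) : ℝ :=
  (n.choose k : ℝ)⁻¹ * ∑ K ∈ Finset.powersetCard k (Finset.univ : Finset (Fin n)), g K

theorem integral_maskedNull (M : Mask n) (f : MvPolynomial M ℝ) :
    ∫ y, MvPolynomial.eval y f ∂maskedNull M = cliqueMean M ∅ f := by
  rw [maskedNull_eq, integral_map_plantedGiven]

theorem integral_maskedPlanted (k : ℕ) (M : Mask n) (f : MvPolynomial M ℝ) :
    ∫ y, MvPolynomial.eval y f ∂maskedPlanted k M = cliqueAvg n k fun K => cliqueMean M K f := by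
  rw [maskedPlanted_eq, integral_smul_measure, integral_finsetSum_measure, cliqueAvg]
  · simp [integral_map_plantedGiven]
  · exact fun K _ => memLp_one_iff_integrable.1 (memLp_eval (ae_map_plantedGiven M K) f 1)

theorem variance_maskedNull (M : Mask n) (f : MvPolynomial M ℝ) :
    variance (fun y => MvPolynomial.eval y f) (maskedNull M) =
      cliqueMean M ∅ (f * f) - cliqueMean M ∅ f ^ 2 := by
  rw [maskedNull_eq, variance_eval (ae_map_plantedGiven M ∅), integral_map_plantedGiven,
    integral_map_plantedGiven]

theorem variance_maskedPlanted {k : ℕ} (hk : k ≤ n) (M : Mask n) (f : MvPolynomial M ℝ) :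
    variance (fun y => MvPolynomial.eval y f) (maskedPlanted k M) =
      (cliqueAvg n k fun K => cliqueMean M K (f * f)) -
        (cliqueAvg n k fun K => cliqueMean M K f) ^ 2 := by
  have := isProbabilityMeasure_maskedPlanted hk M
  rw [variance_eval (ae_maskedPlanted k M), integral_maskedPlanted, integral_maskedPlanted]

/-- Jensen given K. Averaged over K, it bounds the variance of the conditional mean by the planted
variance. -/
theorem sq_cliqueMean_le (M : Mask n) (K : Finset (Fin n)) (f : MvPolynomial M ℝ) :
    cliqueMean M K f ^ 2 ≤ cliqueMean M K (f * f) := by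
  have h := variance_nonneg (fun y => MvPolynomial.eval y f) ((plantedGiven n K).map M.restrict)
  rw [variance_eval (ae_map_plantedGiven M K), integral_map_plantedGiven,
    integral_map_plantedGiven] at h
  linarith

/-! ### Counting the sets that contain a given set -/

/-- Factor by factor, (k - i)/(n - i) ≤ k/n because k ≤ n; the form is cleared of denominators. -/
theorem Nat.descFactorial_mul_pow_le {k n : ℕ} (hk : k ≤ n) (v : ℕ) :
    k.descFactorial v * n ^ v ≤ n.descFactorial v * k ^ v := by
  induction v with
  | zero => simp
  | succ v ih =>
    rw [Nat.descFactorial_succ, Nat.descFactorial_succ, pow_succ, pow_succ]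
    have : (k - v) * n ≤ (n - v) * k := by
      rw [Nat.sub_mul, Nat.sub_mul, mul_comm n k]
      exact Nat.sub_le_sub_left (Nat.mul_le_mul_left v hk) _
    calc _ = ((k - v) * n) * (k.descFactorial v * n ^ v) := by ring
      _ ≤ ((n - v) * k) * (n.descFactorial v * k ^ v) := Nat.mul_le_mul this ih
      _ = _ := by ring

theorem card_supersets_mul_descFactorial {k : ℕ} (U : Finset (Fin n)) :
    (Finset.card {K ∈ Finset.powersetCard k (Finset.univ : Finset (Fin n)) | U ⊆ K}) *
      n.descFactorial U.card = n.choose k * k.descFactorial U.card := by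
  rcases le_or_gt U.card k with h | h
  · rw [Finset.card_filter_powersetCard_subset _ _ _ (Finset.subset_univ _) h]
    have := Nat.choose_mul (n := n) h
    rw [Nat.descFactorial_eq_factorial_mul_choose, Nat.descFactorial_eq_factorial_mul_choose,
      Finset.card_univ, Fintype.card_fin]
    rw [Nat.mul_left_comm (n.choose k), this]
    ring
  · rw [Nat.descFactorial_eq_zero_iff_lt.2 h, mul_zero, Finset.card_eq_zero.2, zero_mul]
    refine Finset.filter_eq_empty_iff.2 fun K hK hU => ?_
    have := Finset.card_le_card hU
    rw [(Finset.mem_powersetCard.1 hK).2] at this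
    omega

/-- The probability that a uniformly random `k`-element set contains `U`. -/
theorem cliqueAvg_subset_eq {k : ℕ} (hk : k ≤ n) (U : Finset (Fin n)) :
    (cliqueAvg n k fun K => if U ⊆ K then 1 else 0) =
      (k.descFactorial U.card : ℝ) / n.descFactorial U.card := by
  have h0 : (0 : ℝ) < n.descFactorial U.card := by
    have : U.card ≤ n := by simpa using Finset.card_le_univ U
    exact_mod_cast Nat.descFactorial_pos.2 this
  have h1 : (0 : ℝ) < n.choose k := by exact_mod_cast Nat.choose_pos hk
  have h2 := card_supersets_mul_descFactorial (n := n) (k := k) U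
  rw [cliqueAvg, Finset.sum_boole, eq_div_iff h0.ne', inv_mul_eq_div, div_mul_eq_mul_div,
    div_eq_iff h1.ne']
  exact_mod_cast h2.trans (mul_comm _ _)

theorem cliqueAvg_subset_le {k : ℕ} (hk : k ≤ n) (U : Finset (Fin n)) :
    (cliqueAvg n k fun K => if U ⊆ K then 1 else 0) ≤ ((k : ℝ) / n) ^ U.card := by
  rw [cliqueAvg_subset_eq hk]
  have hU : U.card ≤ n := by simpa using Finset.card_le_univ U
  have h0 : (0 : ℝ) < n.descFactorial U.card := by exact_mod_cast Nat.descFactorial_pos.2 hU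
  rcases Nat.eq_zero_or_pos U.card with h | h
  · simp [h]
  have hn : (0 : ℝ) < n := by exact_mod_cast h.trans_le hU
  rw [div_pow, div_le_div_iff₀ h0 (by positivity), mul_comm ((k : ℝ) ^ _)]
  exact_mod_cast Nat.descFactorial_mul_pow_le hk U.card

theorem le_cliqueAvg_subset {k : ℕ} (hk : k ≤ n) (U : Finset (Fin n)) (hU : U.card ≤ k) :
    (((k : ℝ) - U.card) / n) ^ U.card ≤ cliqueAvg n k fun K => if U ⊆ K then 1 else 0 := by
  rw [cliqueAvg_subset_eq hk, div_pow]
  have h0 : (0 : ℝ) < n.descFactorial U.card := by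
    exact_mod_cast Nat.descFactorial_pos.2 (hU.trans hk)
  refine div_le_div₀ (by positivity) ?_ h0 ?_
  · have h1 := Nat.pow_sub_le_descFactorial k U.card
    have h2 : (k - U.card) ^ U.card ≤ (k + 1 - U.card) ^ U.card :=
      Nat.pow_le_pow_left (by omega) _
    have h3 : (((k - U.card : ℕ) : ℝ)) ^ U.card ≤ (k.descFactorial U.card : ℝ) := by
      exact_mod_cast h2.trans h1
    rwa [Nat.cast_sub hU] at h3
  · exact_mod_cast Nat.descFactorial_le_pow n U.card

theorem cliqueAvg_mono {k : ℕ} {g h : Finset (Fin n) → ℝ} (H : ∀ K, g K ≤ h K) :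
    cliqueAvg n k g ≤ cliqueAvg n k h :=
  mul_le_mul_of_nonneg_left (Finset.sum_le_sum fun K _ => H K) (by positivity)

theorem cliqueAvg_sum {k : ℕ} {ι : Type*} (s : Finset ι) (g : ι → Finset (Fin n) → ℝ) :
    (cliqueAvg n k fun K => ∑ i ∈ s, g i K) = ∑ i ∈ s, cliqueAvg n k (g i) := by
  simp only [cliqueAvg]
  rw [Finset.sum_comm, Finset.mul_sum]

end Planted

/-! ### Weighted counts of edge sets -/

section EdgeSets

variable {ι W : Type*} [DecidableEq ι] [DecidableEq W] {ends : ι → Finset W}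

/-- A pairwise disjoint subfamily of largest size works: an edge disjoint from its span could be
added. -/
theorem Finset.exists_maximal_matching (hne : ∀ e, (ends e).Nonempty) (S : Finset ι) :
    ∃ F ⊆ S, (F : Set ι).PairwiseDisjoint ends ∧
      ∀ e ∈ S, ¬ Disjoint (ends e) (F.biUnion ends) := by
  classical
  obtain ⟨F, hF, hmax⟩ := Finset.exists_max_image
    (S.powerset.filter fun F : Finset ι => (F : Set ι).PairwiseDisjoint ends) Finset.card
    ⟨∅, by simp⟩
  simp only [Finset.mem_filter, Finset.mem_powerset] at hF hmax
  refine ⟨F, hF.1, hF.2, fun e he hd => ?_⟩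
  have hd' : ∀ e' ∈ F, Disjoint (ends e) (ends e') := fun e' he' =>
    hd.mono_right (Finset.subset_biUnion_of_mem ends he')
  have heF : e ∉ F := fun h => (hne e).ne_empty (Finset.disjoint_self_iff_empty _ |>.1 (hd' e h))
  have := hmax (insert e F) ⟨Finset.insert_subset he hF.1, by
    rw [Finset.coe_insert]
    exact hF.2.insert fun e' he' _ => hd' e' he'⟩
  rw [Finset.card_insert_of_notMem heF] at this
  omega

theorem Finset.sum_powerset_pow_card {α : Type*} [DecidableEq α] (s : Finset α) (x : ℝ) :
    ∑ t ∈ s.powerset, x ^ t.card = (1 + x) ^ s.card := by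
  have := Finset.prod_one_add (f := fun _ : α => x) s
  simpa using this.symm

/-- The vertices that are joined to a vertex of `F` by an edge of `G`. -/
def outerNeighbors (ends : ι → Finset W) (G F : Finset ι) : Finset W :=
  (F.biUnion ends).biUnion fun w => {e ∈ G | w ∈ ends e}.biUnion fun e => (ends e).erase w

theorem card_outerNeighbors_le (h2 : ∀ e, (ends e).card = 2) {G F : Finset ι} {T : ℝ}
    (hT : ∀ w, (({e ∈ G | w ∈ ends e} : Finset ι).card : ℝ) ≤ T) :
    ((outerNeighbors ends G F).card : ℝ) ≤ 2 * F.card * T := by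
  have hspan : ((F.biUnion ends).card : ℝ) ≤ 2 * F.card := by
    have : (F.biUnion ends).card ≤ F.card * 2 := Finset.card_biUnion_le_card_mul _ _ _
      fun e _ => (h2 e).le
    rw [mul_comm]
    exact_mod_cast this
  -- The sign of T is not assumed: a spanned vertex forces T ≥ 0, and without one F is empty.
  have hT0 : 0 ≤ T ∨ (F.biUnion ends) = ∅ := by
    rcases (F.biUnion ends).eq_empty_or_nonempty with h | ⟨w, -⟩
    · exact Or.inr h
    · exact Or.inl ((Nat.cast_nonneg _).trans (hT w))
  rcases hT0 with hT0 | hemp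
  · refine le_trans ?_ (mul_le_mul_of_nonneg_right hspan hT0)
    have h1 : (outerNeighbors ends G F).card ≤
        ∑ w ∈ F.biUnion ends, ({e ∈ G | w ∈ ends e} : Finset ι).card := by
      refine Finset.card_biUnion_le.trans (Finset.sum_le_sum fun w _ => ?_)
      refine (Finset.card_biUnion_le_card_mul _ _ 1 fun e he => ?_).trans (mul_one _).le
      rw [Finset.card_erase_of_mem (Finset.mem_filter.1 he).2, h2]
    calc ((outerNeighbors ends G F).card : ℝ)
        ≤ ∑ w ∈ F.biUnion ends, (({e ∈ G | w ∈ ends e} : Finset ι).card : ℝ) := by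
          exact_mod_cast h1
      _ ≤ ∑ w ∈ F.biUnion ends, T := Finset.sum_le_sum fun w _ => hT w
      _ = _ := by rw [Finset.sum_const, nsmul_eq_mul]
  · have hF : F = ∅ := by
      by_contra hne
      obtain ⟨e, he⟩ := Finset.nonempty_iff_ne_empty.2 hne
      have := Finset.subset_biUnion_of_mem ends he
      rw [hemp, Finset.subset_empty] at this
      simpa [this] using h2 e
    subst hF
    simp [outerNeighbors]

/-- A vertex of S missed by a maximal matching lies on an edge of S that meets the matching, so it
is a neighbour of the matching inside G. -/
theorem exists_matching_of_span (h2 : ∀ e, (ends e).card = 2) {G S : Finset ι} (hS : S ⊆ G)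
    (hne : S.Nonempty) : ∃ F ⊆ G, F.Nonempty ∧ F.biUnion ends ⊆ S.biUnion ends ∧
      (F.biUnion ends).card = 2 * F.card ∧
      S.biUnion ends \ F.biUnion ends ⊆ outerNeighbors ends G F := by
  obtain ⟨F, hFS, hF, hmax⟩ := Finset.exists_maximal_matching (ends := ends)
    (fun e => Finset.card_pos.1 (by rw [h2]; omega)) S
  refine ⟨F, hFS.trans hS, ?_, Finset.biUnion_subset_biUnion_of_subset_left _ hFS, ?_, ?_⟩
  · obtain ⟨e, he⟩ := hne
    by_contra h
    rw [Finset.not_nonempty_iff_eq_empty] at h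
    subst h
    exact hmax e he (by simp)
  · rw [Finset.card_biUnion hF, Finset.sum_congr rfl fun e _ => h2 e, Finset.sum_const,
      smul_eq_mul, mul_comm]
  · intro u hu
    obtain ⟨hu, huF⟩ := Finset.mem_sdiff.1 hu
    obtain ⟨e, he, hue⟩ := Finset.mem_biUnion.1 hu
    obtain ⟨w, hwe, hw⟩ := Finset.not_disjoint_iff.1 (hmax e he)
    refine Finset.mem_biUnion.2 ⟨w, hw, Finset.mem_biUnion.2 ⟨e, ?_, ?_⟩⟩
    · exact Finset.mem_filter.2 ⟨hS he, hwe⟩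
    · exact Finset.mem_erase.2 ⟨fun h => huF (h ▸ hw), hue⟩

/-- The vertex sets of the nonempty edge sets inside `G`, counted with weight `x` per vertex. -/
theorem sum_pow_card_span_le (h2 : ∀ e, (ends e).card = 2) {G : Finset ι} {T x : ℝ}
    (hx : 0 ≤ x) (hT : ∀ w, (({e ∈ G | w ∈ ends e} : Finset ι).card : ℝ) ≤ T) (hxT : x * T ≤ 1) :
    ∑ V ∈ (G.powerset.erase ∅).image (fun S => S.biUnion ends), x ^ V.card ≤
      (1 + (x * Real.exp 1) ^ 2) ^ G.card - 1 := by
  classical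
  have hex : ∀ V ∈ (G.powerset.erase ∅).image (fun S => S.biUnion ends),
      ∃ F ∈ G.powerset.erase ∅, F.biUnion ends ⊆ V ∧
      (F.biUnion ends).card = 2 * F.card ∧ V \ F.biUnion ends ⊆ outerNeighbors ends G F := by
    intro V hV
    obtain ⟨S, hS, rfl⟩ := Finset.mem_image.1 hV
    obtain ⟨hS0, hSG⟩ := Finset.mem_erase.1 hS
    obtain ⟨F, hF, hF0, h⟩ := exists_matching_of_span h2 (Finset.mem_powerset.1 hSG)
      (Finset.nonempty_iff_ne_empty.2 hS0)
    exact ⟨F, Finset.mem_erase.2 ⟨hF0.ne_empty, Finset.mem_powerset.2 hF⟩, h⟩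
  choose! Φ hΦG hΦsub hΦcard hΦout using hex
  set 𝒱 := (G.powerset.erase ∅).image (fun S => S.biUnion ends)
  -- V is recovered from its matching and the leftover vertices, so the sum over V is dominated by a
  -- sum over all matchings F and all subsets of the outer neighbours of F; F is then relaxed to any
  -- nonempty edge set.
  let Ψ : Finset W → (Σ _ : Finset ι, Finset W) := fun V => ⟨Φ V, V \ (Φ V).biUnion ends⟩
  have hinj : Set.InjOn Ψ 𝒱 := by
    intro V hV V' hV' h
    have h1 : Φ V = Φ V' := congrArg Sigma.fst h
    have h2 : V \ (Φ V).biUnion ends = V' \ (Φ V').biUnion ends := congrArg Sigma.snd h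
    rw [← Finset.sdiff_union_of_subset (hΦsub V hV), h2, h1,
      Finset.sdiff_union_of_subset (hΦsub V' hV')]
  calc ∑ V ∈ 𝒱, x ^ V.card
      = ∑ z ∈ 𝒱.image Ψ, x ^ (2 * z.1.card + z.2.card) := by
        rw [Finset.sum_image hinj]
        refine Finset.sum_congr rfl fun V hV => ?_
        rw [← hΦcard V hV, add_comm, Finset.card_sdiff_add_card_eq_card (hΦsub V hV)]
    _ ≤ ∑ z ∈ (G.powerset.erase ∅).sigma fun F => (outerNeighbors ends G F).powerset,
          x ^ (2 * z.1.card + z.2.card) := by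
        refine Finset.sum_le_sum_of_subset_of_nonneg ?_ fun _ _ _ => by positivity
        intro z hz
        obtain ⟨V, hV, rfl⟩ := Finset.mem_image.1 hz
        exact Finset.mem_sigma.2 ⟨hΦG V hV, Finset.mem_powerset.2 (hΦout V hV)⟩
    _ = ∑ F ∈ G.powerset.erase ∅, x ^ (2 * F.card) *
          (1 + x) ^ (outerNeighbors ends G F).card := by
        rw [Finset.sum_sigma]
        refine Finset.sum_congr rfl fun F _ => ?_
        rw [← Finset.sum_powerset_pow_card, Finset.mul_sum]
        exact Finset.sum_congr rfl fun U _ => pow_add _ _ _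
    _ ≤ ∑ F ∈ G.powerset.erase ∅, ((x * Real.exp 1) ^ 2) ^ F.card := by
        refine Finset.sum_le_sum fun F _ => ?_
        -- There are at most 2|F|T outer neighbours and xT ≤ 1, so choosing among them costs at most
        -- e² per edge of F.
        have h : (1 + x) ^ (outerNeighbors ends G F).card ≤ Real.exp 1 ^ (2 * F.card) := by
          calc (1 + x) ^ (outerNeighbors ends G F).card
              ≤ Real.exp x ^ (outerNeighbors ends G F).card := by
                gcongr; linarith [Real.add_one_le_exp x]
            _ = Real.exp ((outerNeighbors ends G F).card * x) := by rw [Real.exp_nat_mul]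
            _ ≤ Real.exp (((2 * F.card : ℕ) : ℝ) * 1) := by
                refine Real.exp_le_exp.2 ?_
                calc _ ≤ (2 * F.card * T) * x :=
                      mul_le_mul_of_nonneg_right (card_outerNeighbors_le h2 hT) hx
                  _ = 2 * F.card * (x * T) := by ring
                  _ ≤ 2 * F.card * 1 := by gcongr
                  _ = _ := by push_cast; ring
            _ = _ := Real.exp_nat_mul _ _
        calc _ ≤ x ^ (2 * F.card) * Real.exp 1 ^ (2 * F.card) := by gcongr
          _ = _ := by rw [← mul_pow, pow_mul]
    _ = _ := by
        rw [← Finset.sum_powerset_pow_card, ← Finset.add_sum_erase _ _ (Finset.empty_mem_powerset G)]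
        simp

/-- The edge sets of at most `D` edges with a given vertex set. -/
theorem card_filter_span_le (hinj : Function.Injective ends) (h2 : ∀ e, (ends e).card = 2)
    (𝒮 : Finset (Finset ι)) (V : Finset W) {D : ℕ} {l : ℝ} (hl : 0 < l) (hD : (D : ℝ) ≤ l ^ 2) :
    (({S ∈ 𝒮 | S.card ≤ D ∧ S.biUnion ends = V} : Finset (Finset ι)).card : ℝ) ≤
      Real.exp (2 * l) ^ V.card := by
  classical
  set 𝒯 : Finset (Finset ι) := {S ∈ 𝒮 | S.card ≤ D ∧ S.biUnion ends = V}
  set E : Finset ι := {e ∈ 𝒮.biUnion id | ends e ⊆ V}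
  have hE : E.card ≤ V.card ^ 2 := by
    calc E.card = (E.image ends).card := (Finset.card_image_of_injective _ hinj).symm
      _ ≤ (V.powersetCard 2).card := by
          refine Finset.card_le_card fun s hs => ?_
          obtain ⟨e, he, rfl⟩ := Finset.mem_image.1 hs
          exact Finset.mem_powersetCard.2 ⟨(Finset.mem_filter.1 he).2, h2 e⟩
      _ ≤ V.card ^ 2 := by rw [Finset.card_powersetCard]; exact Nat.choose_le_pow _ _
  have hsub : 𝒯 ⊆ E.powerset := by
    intro S hS
    obtain ⟨hS, -, hV⟩ := Finset.mem_filter.1 hS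
    refine Finset.mem_powerset.2 fun e he => Finset.mem_filter.2 ⟨?_, ?_⟩
    · exact Finset.mem_biUnion.2 ⟨S, hS, he⟩
    · exact hV ▸ Finset.subset_biUnion_of_mem ends he
  have hexp : ∀ t : ℝ, 0 ≤ t → (1 + t) ^ E.card ≤ Real.exp (t * V.card * V.card) := by
    intro t ht
    calc (1 + t) ^ E.card ≤ Real.exp t ^ E.card := by
          gcongr; linarith [Real.add_one_le_exp t]
      _ = Real.exp (E.card * t) := (Real.exp_nat_mul _ _).symm
      _ ≤ _ := by
          refine Real.exp_le_exp.2 ?_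
          have : (E.card : ℝ) ≤ (V.card : ℝ) ^ 2 := by exact_mod_cast hE
          nlinarith
  rw [← Real.exp_nat_mul]
  rcases le_or_gt (V.card : ℝ) l with h | h
  · calc (𝒯.card : ℝ) ≤ E.powerset.card := by exact_mod_cast Finset.card_le_card hsub
      _ = (1 + 1) ^ E.card := by rw [Finset.card_powerset]; norm_num
      _ ≤ Real.exp (1 * V.card * V.card) := hexp 1 zero_le_one
      _ ≤ _ := by
          refine Real.exp_le_exp.2 ?_
          have : (0 : ℝ) ≤ V.card := Nat.cast_nonneg _
          nlinarith
  · have hv : (0 : ℝ) < V.card := hl.trans h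
    set t : ℝ := l / V.card
    have ht0 : 0 < t := by positivity
    have ht1 : t ≤ 1 := (div_le_one hv).2 h.le
    have h1 : (𝒯.card : ℝ) * t ^ D ≤ (1 + t) ^ E.card := by
      calc (𝒯.card : ℝ) * t ^ D = ∑ S ∈ 𝒯, t ^ D := by rw [Finset.sum_const, nsmul_eq_mul]
        _ ≤ ∑ S ∈ 𝒯, t ^ S.card := Finset.sum_le_sum fun S hS =>
            pow_le_pow_of_le_one ht0.le ht1 (Finset.mem_filter.1 hS).2.1
        _ ≤ ∑ S ∈ E.powerset, t ^ S.card :=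
            Finset.sum_le_sum_of_subset_of_nonneg hsub fun _ _ _ => by positivity
        _ = _ := Finset.sum_powerset_pow_card _ _
    have h3 : (t⁻¹) ^ D ≤ Real.exp (l * V.card) := by
      calc (t⁻¹) ^ D ≤ Real.exp (t⁻¹) ^ D := by
            gcongr; linarith [Real.add_one_le_exp t⁻¹]
        _ = Real.exp (D * t⁻¹) := (Real.exp_nat_mul _ _).symm
        _ ≤ _ := by
            refine Real.exp_le_exp.2 ?_
            rw [inv_div, mul_div_assoc', div_le_iff₀ hl]
            nlinarith
    calc (𝒯.card : ℝ) = (𝒯.card * t ^ D) * (t⁻¹) ^ D := by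
          rw [mul_assoc, ← mul_pow, mul_inv_cancel₀ ht0.ne', one_pow, mul_one]
      _ ≤ Real.exp (t * V.card * V.card) * Real.exp (l * V.card) := by
          gcongr
          exact h1.trans (hexp t ht0.le)
      _ = _ := by
          rw [← Real.exp_add, div_mul_cancel₀ _ hv.ne']
          congr 1; ring

/-- Grouping edge sets by their span absorbs the multiplicity into the weight: q per vertex becomes
q exp(2l). -/
theorem sum_pow_card_span_edgeSets_le (hinj : Function.Injective ends)
    (h2 : ∀ e, (ends e).card = 2) {G : Finset ι} {T q l : ℝ} {D : ℕ} (hq : 0 ≤ q) (hl : 0 < l)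
    (hD : (D : ℝ) ≤ l ^ 2) (hT : ∀ w, (({e ∈ G | w ∈ ends e} : Finset ι).card : ℝ) ≤ T)
    (hqT : q * Real.exp (2 * l) * T ≤ 1) :
    ∑ S ∈ G.powerset.erase ∅ with S.card ≤ D, q ^ (S.biUnion ends).card ≤
      Real.exp (G.card * (q * Real.exp (2 * l) * Real.exp 1) ^ 2) - 1 := by
  classical
  have hmaps : ∀ S ∈ (G.powerset.erase ∅).filter (fun S => S.card ≤ D),
      S.biUnion ends ∈ (G.powerset.erase ∅).image (fun S => S.biUnion ends) := fun S hS =>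
    Finset.mem_image_of_mem _ (Finset.mem_filter.1 hS).1
  rw [← Finset.sum_fiberwise_of_maps_to hmaps]
  calc _ ≤ ∑ V ∈ (G.powerset.erase ∅).image (fun S => S.biUnion ends),
          (q * Real.exp (2 * l)) ^ V.card := by
        refine Finset.sum_le_sum fun V _ => ?_
        rw [Finset.sum_congr rfl (g := fun _ => q ^ V.card)
          fun S hS => by rw [(Finset.mem_filter.1 hS).2], Finset.sum_const, nsmul_eq_mul,
          Finset.filter_filter, mul_pow, mul_comm]
        exact mul_le_mul_of_nonneg_left (card_filter_span_le hinj h2 _ V hl hD) (by positivity)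
    _ ≤ _ := sum_pow_card_span_le h2 (by positivity) hT hqT
    _ ≤ _ := by
        rw [Real.exp_nat_mul]
        gcongr
        rw [add_comm]
        exact Real.add_one_le_exp _

end EdgeSets

/-! ### Polynomials of low degree on a mask -/

section LowerBound

variable {n : ℕ}

/-- The two ends of an edge of a mask. -/
def maskEnds (M : Mask n) (e : M) : Finset (Fin n) := e.1.1.toFinset

theorem card_maskEnds (M : Mask n) (e : M) : (maskEnds M e).card = 2 :=
  Sym2.card_toFinset_of_not_isDiag _ e.1.2

theorem maskEnds_injective (M : Mask n) : Function.Injective (maskEnds M) := by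
  intro e e' h
  refine Subtype.ext (Subtype.ext (Sym2.ext fun v => ?_))
  rw [← Sym2.mem_toFinset, ← Sym2.mem_toFinset]
  exact Finset.ext_iff.1 h v

theorem inside_iff_maskEnds_subset {M : Mask n} {K : Finset (Fin n)} (e : M) :
    e.1.Inside K ↔ maskEnds M e ⊆ K := by
  simp [VertexPair.Inside, maskEnds, Finset.subset_iff]

theorem integral_restrict_prod_mul_prod (M : Mask n) (K : Finset (Fin n)) (S S' : Finset M) :
    ∫ y, (∏ e ∈ S, M.restrict y e) * ∏ e ∈ S', M.restrict y e ∂plantedGiven n K =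
      if (symmDiff S S').biUnion (maskEnds M) ⊆ K then 1 else 0 := by
  classical
  have h := integral_prod_mul_prod K (S.map (Function.Embedding.subtype _))
    (S'.map (Function.Embedding.subtype _))
  simp only [Finset.prod_map] at h
  refine h.trans (if_congr ?_ rfl rfl)
  rw [Finset.biUnion_subset]
  simp only [← inside_iff_maskEnds_subset, Finset.mem_symmDiff, Finset.mem_map]
  constructor
  · intro H e he
    refine H e.1 ?_
    simpa using he
  · intro H e he
    have heM : e ∈ M := by
      rcases he with ⟨⟨x, _, rfl⟩, -⟩ | ⟨⟨x, _, rfl⟩, -⟩ <;> exact x.2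
    refine H ⟨e, heM⟩ ?_
    simpa [heM] using he

theorem integrable_restrict_prod_mul_prod (M : Mask n) (K : Finset (Fin n)) (S S' : Finset M) :
    Integrable (fun y => (∏ e ∈ S, M.restrict y e) * ∏ e ∈ S', M.restrict y e)
      (plantedGiven n K) := by
  have h := memLp_eval (ae_plantedGiven K) ((∏ e ∈ S, MvPolynomial.X e.1) *
    ∏ e ∈ S', MvPolynomial.X e.1) 1
  simpa [MvPolynomial.eval_prod, memLp_one_iff_integrable] using h

/-- The expansion of `f` into squarefree monomials on sign vectors. -/
def IsSignExpansion {ι : Type*} [Fintype ι] (c : Finset ι → ℝ) (f : MvPolynomial ι ℝ) : Prop :=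
  ∀ y : ι → ℝ, (∀ i, y i ^ 2 = 1) → MvPolynomial.eval y f = ∑ S, c S * ∏ i ∈ S, y i

theorem IsSignExpansion.cliqueMean_eq {M : Mask n} {c : Finset M → ℝ} {f : MvPolynomial M ℝ}
    (hc : IsSignExpansion c f) (K : Finset (Fin n)) :
    cliqueMean M K f = ∑ S, c S * if S.biUnion (maskEnds M) ⊆ K then 1 else 0 := by
  have h : ∀ᵐ y ∂plantedGiven n K, MvPolynomial.eval (M.restrict y) f =
      ∑ S, c S * ((∏ e ∈ S, M.restrict y e) * ∏ e ∈ (∅ : Finset M), M.restrict y e) := by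
    filter_upwards [ae_restrict_plantedGiven M K] with y hy
    rw [hc _ hy]
    simp
  rw [cliqueMean, integral_congr_ae h, integral_finsetSum _ fun S _ =>
    (integrable_restrict_prod_mul_prod M K S ∅).const_mul _]
  refine Finset.sum_congr rfl fun S _ => ?_
  rw [integral_const_mul, integral_restrict_prod_mul_prod, ← Finset.bot_eq_empty, symmDiff_bot]

theorem biUnion_maskEnds_subset_empty {M : Mask n} {S : Finset M} :
    S.biUnion (maskEnds M) ⊆ ∅ ↔ S = ∅ := by
  refine ⟨fun h => ?_, fun h => by simp [h]⟩
  by_contra hne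
  obtain ⟨e, he⟩ := Finset.nonempty_iff_ne_empty.2 hne
  have := card_maskEnds M e
  rw [Finset.subset_empty.1 ((Finset.subset_biUnion_of_mem (maskEnds M) he).trans h)] at this
  simp at this

theorem IsSignExpansion.cliqueMean_empty {M : Mask n} {c : Finset M → ℝ} {f : MvPolynomial M ℝ}
    (hc : IsSignExpansion c f) : cliqueMean M ∅ f = c ∅ := by
  simp only [hc.cliqueMean_eq, biUnion_maskEnds_subset_empty]
  simp

/-- Parseval: under uniform signs distinct squarefree monomials are orthogonal. -/
theorem IsSignExpansion.cliqueMean_empty_mul_self {M : Mask n} {c : Finset M → ℝ}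
    {f : MvPolynomial M ℝ} (hc : IsSignExpansion c f) :
    cliqueMean M ∅ (f * f) = ∑ S, c S ^ 2 := by
  have h : ∀ᵐ y ∂plantedGiven n ∅, MvPolynomial.eval (M.restrict y) (f * f) =
      ∑ S, ∑ S', (c S * c S') * ((∏ e ∈ S, M.restrict y e) * ∏ e ∈ S', M.restrict y e) := by
    filter_upwards [ae_restrict_plantedGiven M ∅] with y hy
    rw [map_mul, hc _ hy, Finset.sum_mul_sum]
    refine Finset.sum_congr rfl fun S _ => Finset.sum_congr rfl fun S' _ => ?_
    ring
  rw [cliqueMean, integral_congr_ae h, integral_finsetSum _ fun S _ => integrable_finsetSum _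
    fun S' _ => (integrable_restrict_prod_mul_prod M ∅ S S').const_mul _]
  refine Finset.sum_congr rfl fun S _ => ?_
  rw [integral_finsetSum _ fun S' _ => (integrable_restrict_prod_mul_prod M ∅ S S').const_mul _]
  simp only [integral_const_mul, integral_restrict_prod_mul_prod, biUnion_maskEnds_subset_empty]
  rw [Finset.sum_eq_single S]
  · simp [sq, ← Finset.bot_eq_empty]
  · intro S' _ hne
    rw [if_neg, mul_zero]
    rw [← Finset.bot_eq_empty, symmDiff_eq_bot]
    exact hne.symm
  · simp

theorem IsSignExpansion.variance_maskedNull_eq {M : Mask n} {c : Finset M → ℝ}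
    {f : MvPolynomial M ℝ} (hc : IsSignExpansion c f) :
    variance (fun y => MvPolynomial.eval y f) (maskedNull M) =
      ∑ S ∈ Finset.univ.erase ∅, c S ^ 2 := by
  rw [variance_maskedNull, hc.cliqueMean_empty, hc.cliqueMean_empty_mul_self,
    ← Finset.add_sum_erase _ _ (Finset.mem_univ ∅)]
  ring

/-- Restricting an average to an event of probability at least `1 - ρ` moves it by at most
`√(ρ * v)`, where `v` is the variance. -/
theorem sq_sum_sub_le {α : Type*} {Ω Ω' : Finset α} (hsub : Ω' ⊆ Ω) [DecidableEq α] (a : α → ℝ)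
    {μ v N ρ : ℝ} (hN : 0 < N) (hcard : (Ω.card : ℝ) = N) (hμ : μ = N⁻¹ * ∑ x ∈ Ω, a x)
    (hv : N⁻¹ * ∑ x ∈ Ω, a x ^ 2 - μ ^ 2 ≤ v) (hρ : N⁻¹ * (Ω \ Ω').card ≤ ρ) :
    (N⁻¹ * ∑ x ∈ Ω', a x - N⁻¹ * Ω'.card * μ) ^ 2 ≤ ρ * v := by
  have hμ' : ∑ x ∈ Ω, a x = N * μ := by rw [hμ]; field_simp
  have h1 : ∑ x ∈ Ω, (a x - μ) = 0 := by
    rw [Finset.sum_sub_distrib, hμ', Finset.sum_const, nsmul_eq_mul, hcard, sub_self]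
  have h2 : ∑ x ∈ Ω, (a x - μ) ^ 2 = N * (N⁻¹ * ∑ x ∈ Ω, a x ^ 2 - μ ^ 2) := by
    have : ∀ x, (a x - μ) ^ 2 = a x ^ 2 - 2 * μ * a x + μ ^ 2 := fun x => by ring
    simp only [this]
    rw [Finset.sum_add_distrib, Finset.sum_sub_distrib, ← Finset.mul_sum, hμ', Finset.sum_const,
      nsmul_eq_mul, hcard]
    field_simp
    ring
  -- Deviations from the mean sum to zero, so the sum over Ω' can be traded for one over the few
  -- discarded points, where Cauchy–Schwarz gains the factor ρ.
  have h3 : ∑ x ∈ Ω', (a x - μ) = -∑ x ∈ Ω \ Ω', (a x - μ) := by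
    rw [← Finset.sum_sdiff hsub] at h1
    linarith
  have h4 : (∑ x ∈ Ω \ Ω', (a x - μ)) ^ 2 ≤ (Ω \ Ω').card * ∑ x ∈ Ω, (a x - μ) ^ 2 :=
    sq_sum_le_card_mul_sum_sq.trans (mul_le_mul_of_nonneg_left
      (Finset.sum_le_sum_of_subset_of_nonneg Finset.sdiff_subset fun _ _ _ => sq_nonneg _)
      (Nat.cast_nonneg _))
  have h5 : N⁻¹ * ∑ x ∈ Ω', a x - N⁻¹ * Ω'.card * μ = N⁻¹ * ∑ x ∈ Ω', (a x - μ) := by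
    rw [Finset.sum_sub_distrib, Finset.sum_const, nsmul_eq_mul]
    ring
  have h6 : 0 ≤ N⁻¹ * ∑ x ∈ Ω, a x ^ 2 - μ ^ 2 := by
    have : 0 ≤ ∑ x ∈ Ω, (a x - μ) ^ 2 := Finset.sum_nonneg fun _ _ => sq_nonneg _
    rw [h2] at this
    exact nonneg_of_mul_nonneg_right this hN
  rw [h5, h3, mul_pow, neg_sq]
  calc N⁻¹ ^ 2 * (∑ x ∈ Ω \ Ω', (a x - μ)) ^ 2
      ≤ N⁻¹ ^ 2 * ((Ω \ Ω').card * ∑ x ∈ Ω, (a x - μ) ^ 2) := by gcongr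
    _ = (N⁻¹ * (Ω \ Ω').card) * (N⁻¹ * ∑ x ∈ Ω, a x ^ 2 - μ ^ 2) := by
        rw [h2]
        linear_combination (N⁻¹ * (Ω \ Ω').card * (N⁻¹ * ∑ x ∈ Ω, a x ^ 2 - μ ^ 2)) *
          inv_mul_cancel₀ hN.ne'
    _ ≤ ρ * v := mul_le_mul hρ hv h6
        ((mul_nonneg (inv_nonneg.2 hN.le) (Nat.cast_nonneg _)).trans hρ)

theorem cliqueAvg_not_disjoint_le {k : ℕ} (hk : k ≤ n) (H : Finset (Fin n)) :
    (cliqueAvg n k fun K => if Disjoint K H then 0 else 1) ≤ H.card * ((k : ℝ) / n) := by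
  calc _ ≤ cliqueAvg n k fun K => ∑ h ∈ H, if {h} ⊆ K then 1 else 0 := by
        refine cliqueAvg_mono fun K => ?_
        split_ifs with hd
        · exact Finset.sum_nonneg fun _ _ => by split_ifs <;> norm_num
        · obtain ⟨h, hK, hH⟩ := Finset.not_disjoint_iff.1 hd
          refine le_trans ?_ (Finset.single_le_sum
            (f := fun h => if {h} ⊆ K then (1 : ℝ) else 0) (fun _ _ => ?_) hH)
          · simp [hK]
          · split_ifs <;> norm_num
    _ = ∑ h ∈ H, cliqueAvg n k fun K => if {h} ⊆ K then 1 else 0 := cliqueAvg_sum _ _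
    _ ≤ ∑ h ∈ H, (k : ℝ) / n := Finset.sum_le_sum fun h _ => by
        simpa using cliqueAvg_subset_le hk {h}
    _ = _ := by rw [Finset.sum_const, nsmul_eq_mul]

/-- The gap between the means in terms of the weighted count of the edge sets that avoid `H`. -/
theorem meanGap_le_of_avoid {k : ℕ} (hk : k ≤ n) {M : Mask n} (f : MvPolynomial M ℝ)
    (H : Finset (Fin n)) {ρ B : ℝ} (hρ : H.card * ((k : ℝ) / n) ≤ ρ) (hρ2 : ρ ≤ 1 / 2)
    (hB : ∑ S ∈ (Finset.powerset {e : M | Disjoint (maskEnds M e) H}).erase ∅ with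
      S.card ≤ f.totalDegree, (((k : ℝ) / n) ^ 2) ^ (S.biUnion (maskEnds M)).card ≤ B) :
    meanGap (maskedPlanted k M) (maskedNull M) f ≤
      2 * (√ρ + √B) * maxStd (maskedPlanted k M) (maskedNull M) f := by
  classical
  obtain ⟨c, hcdeg, hc⟩ := f.exists_multilinear
  have hc : IsSignExpansion c f := hc
  set Ω := Finset.powersetCard k (Finset.univ : Finset (Fin n))
  set Ω' := Ω.filter fun K => Disjoint K H
  set N : ℝ := (n.choose k : ℝ)
  have hN : 0 < N := by simpa [N] using Nat.choose_pos hk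
  have hcard : (Ω.card : ℝ) = N := by simp [Ω, N]
  set a : Finset (Fin n) → ℝ := fun K => cliqueMean M K f
  set vP := variance (fun y => MvPolynomial.eval y f) (maskedPlanted k M)
  set vQ := variance (fun y => MvPolynomial.eval y f) (maskedNull M)
  set μ := cliqueAvg n k a
  set w := N⁻¹ * Ω'.card
  set A := N⁻¹ * ∑ K ∈ Ω', a K
  have hout : N⁻¹ * (Ω \ Ω').card ≤ ρ := by
    refine le_trans (le_of_eq ?_) ((cliqueAvg_not_disjoint_le hk H).trans hρ)
    rw [cliqueAvg]
    congr 1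
    have : ∀ K : Finset (Fin n), (if Disjoint K H then (0 : ℝ) else 1) =
        if ¬ Disjoint K H then 1 else 0 := fun K => by split_ifs <;> rfl
    simp only [this]
    rw [Finset.sum_boole, Finset.filter_not]
  have hw : 1 / 2 ≤ w := by
    have h1 : ((Ω \ Ω').card : ℝ) + Ω'.card = N := by
      rw [← hcard]
      exact_mod_cast Finset.card_sdiff_add_card_eq_card (Finset.filter_subset _ _)
    have h2 : N⁻¹ * (Ω \ Ω').card + w = 1 := by
      rw [← mul_add, h1, inv_mul_cancel₀ hN.ne']
    linarith
  have hstep : |A - w * μ| ≤ √ρ * √vP := by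
    have hρ0 : 0 ≤ ρ := (mul_nonneg (inv_nonneg.2 hN.le) (Nat.cast_nonneg _)).trans hout
    rw [← Real.sqrt_mul hρ0]
    refine Real.abs_le_sqrt (sq_sum_sub_le (Finset.filter_subset _ _) a hN hcard rfl ?_ hout)
    change _ ≤ variance _ _
    rw [variance_maskedPlanted hk]
    refine sub_le_sub_right ?_ _
    exact mul_le_mul_of_nonneg_left (Finset.sum_le_sum fun K _ => sq_cliqueMean_le M K f)
      (by positivity)
  set p : Finset M → ℝ := fun S =>
    N⁻¹ * ∑ K ∈ Ω', if S.biUnion (maskEnds M) ⊆ K then 1 else 0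
  have hA : A = ∑ S, c S * p S := by
    simp only [A, a, p, hc.cliqueMean_eq]
    rw [Finset.sum_comm, Finset.mul_sum]
    refine Finset.sum_congr rfl fun S _ => ?_
    rw [← Finset.mul_sum]
    ring
  have hp0 : p ∅ = w := by simp [p, w]
  have hpnn : ∀ S, 0 ≤ p S := fun S => mul_nonneg (by positivity)
    (Finset.sum_nonneg fun _ _ => by split_ifs <;> norm_num)
  have hpz : ∀ S, ¬ Disjoint (S.biUnion (maskEnds M)) H → p S = 0 := by
    intro S hS
    refine mul_eq_zero_of_right _ (Finset.sum_eq_zero fun K hK => if_neg fun h => hS ?_)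
    exact (Finset.mem_filter.1 hK).2.mono_left h
  have hple : ∀ S, p S ≤ ((k : ℝ) / n) ^ (S.biUnion (maskEnds M)).card := by
    intro S
    refine le_trans ?_ (cliqueAvg_subset_le hk _)
    refine mul_le_mul_of_nonneg_left ?_ (by positivity)
    exact Finset.sum_le_sum_of_subset_of_nonneg (Finset.filter_subset _ _)
      fun _ _ _ => by split_ifs <;> norm_num
  -- The term S = ∅ contributes w times the null mean. The others vanish unless S avoids H and has
  -- at most deg f edges; Cauchy–Schwarz then pairs p with c, whose square sum is controlled by the
  -- null variance.
  have hstep2 : |A - w * c ∅| ≤ √B * √vQ := by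
    set 𝒮 := ((Finset.powerset {e : M | Disjoint (maskEnds M e) H}).erase ∅).filter
      fun S => S.card ≤ f.totalDegree
    have h1 : A - w * c ∅ = ∑ S ∈ 𝒮, p S * c S := by
      rw [hA, ← Finset.add_sum_erase _ _ (Finset.mem_univ ∅), hp0]
      rw [mul_comm w, add_sub_cancel_left]
      symm
      rw [Finset.sum_congr rfl fun S _ => mul_comm (p S) (c S)]
      refine Finset.sum_subset ?_ ?_
      · intro S hS
        exact Finset.mem_erase.2
          ⟨(Finset.mem_erase.1 (Finset.mem_filter.1 hS).1).1, Finset.mem_univ _⟩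
      · intro S hS hS'
        rcases lt_or_ge f.totalDegree S.card with hd | hd
        · rw [hcdeg S hd, zero_mul]
        · rw [hpz S, mul_zero]
          intro hdis
          refine hS' (Finset.mem_filter.2 ⟨Finset.mem_erase.2 ⟨(Finset.mem_erase.1 hS).1, ?_⟩, hd⟩)
          rw [Finset.disjoint_biUnion_left] at hdis
          exact Finset.mem_powerset.2 fun e he => Finset.mem_filter.2 ⟨Finset.mem_univ _, hdis e he⟩
    have h2 : ∑ S ∈ 𝒮, p S ^ 2 ≤ B := by
      refine le_trans (Finset.sum_le_sum fun S _ => ?_) hB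
      rw [pow_right_comm]
      exact pow_le_pow_left₀ (hpnn S) (hple S) 2
    have h3 : ∑ S ∈ 𝒮, c S ^ 2 ≤ vQ := by
      change _ ≤ variance _ _
      rw [hc.variance_maskedNull_eq]
      refine Finset.sum_le_sum_of_subset_of_nonneg ?_ fun _ _ _ => sq_nonneg _
      intro S hS
      exact Finset.mem_erase.2
        ⟨(Finset.mem_erase.1 (Finset.mem_filter.1 hS).1).1, Finset.mem_univ _⟩
    have hB0 : 0 ≤ B := (Finset.sum_nonneg fun _ _ => sq_nonneg _).trans h2
    rw [← Real.sqrt_mul hB0]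
    refine Real.abs_le_sqrt ?_
    rw [h1]
    exact (Finset.sum_mul_sq_le_sq_mul_sq _ _ _).trans
      (mul_le_mul h2 h3 (Finset.sum_nonneg fun _ _ => sq_nonneg _) hB0)
  have hσP : √vP ≤ maxStd (maskedPlanted k M) (maskedNull M) f :=
    Real.sqrt_le_sqrt (le_max_left _ _)
  have hσQ : √vQ ≤ maxStd (maskedPlanted k M) (maskedNull M) f :=
    Real.sqrt_le_sqrt (le_max_right _ _)
  have hgap : meanGap (maskedPlanted k M) (maskedNull M) f = |μ - c ∅| := by
    rw [meanGap, integral_maskedPlanted, integral_maskedNull, hc.cliqueMean_empty]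
  rw [hgap]
  -- The truncated mean A is close both to w times the planted mean and to w times the null mean; w
  -- ≥ 1/2 then costs the factor 2.
  have h1 : w * |μ - c ∅| ≤ √ρ * √vP + √B * √vQ := by
    rw [← abs_of_nonneg (a := w) (by linarith), ← abs_mul]
    have : w * (μ - c ∅) = -(A - w * μ) + (A - w * c ∅) := by ring
    rw [this]
    refine (abs_add_le _ _).trans (add_le_add ?_ hstep2)
    rwa [abs_neg]
  have h2 : 1 / 2 * |μ - c ∅| ≤ w * |μ - c ∅| := by gcongr
  have h3 := mul_le_mul_of_nonneg_left hσP (Real.sqrt_nonneg ρ)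
  have h4 := mul_le_mul_of_nonneg_left hσQ (Real.sqrt_nonneg B)
  linarith

/-- The gap between the means of a polynomial whose degree is at most `l ^ 2`; the parameter `T`
separates vertices of high and low degree in the mask. -/
theorem meanGap_le {k : ℕ} (hk : k ≤ n) {M : Mask n} (f : MvPolynomial M ℝ) {T l : ℝ}
    (hT : 0 < T) (hl : 0 < l) (hD : (f.totalDegree : ℝ) ≤ l ^ 2)
    (hqT : ((k : ℝ) / n) ^ 2 * Real.exp (2 * l) * T ≤ 1)
    (hρ : 2 * M.card / T * ((k : ℝ) / n) ≤ 1 / 2) :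
    meanGap (maskedPlanted k M) (maskedNull M) f ≤
      2 * (√(2 * M.card / T * ((k : ℝ) / n)) +
        √(Real.exp (M.card * (((k : ℝ) / n) ^ 2 * Real.exp (2 * l) * Real.exp 1) ^ 2) - 1)) *
      maxStd (maskedPlanted k M) (maskedNull M) f := by
  classical
  set H : Finset (Fin n) := {w | T < (({e : M | w ∈ maskEnds M e} : Finset M).card : ℝ)}
  refine meanGap_le_of_avoid hk f H ?_ hρ ?_
  · refine mul_le_mul_of_nonneg_right ?_ (by positivity)
    rw [le_div_iff₀ hT]
    -- Handshake identity; with Markov's inequality it gives |H| T ≤ 2|M|.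
    have h1 : ∑ w, (({e : M | w ∈ maskEnds M e} : Finset M).card : ℝ) = 2 * M.card := by
      have := Finset.sum_card_bipartiteAbove_eq_sum_card_bipartiteBelow
        (s := (Finset.univ : Finset (Fin n))) (t := (Finset.univ : Finset M))
        (fun w e => w ∈ maskEnds M e)
      simp only [Finset.bipartiteAbove, Finset.bipartiteBelow, Finset.filter_univ_mem,
        card_maskEnds, Finset.sum_const, Finset.card_univ, Fintype.card_coe, smul_eq_mul] at this
      rw [mul_comm]
      exact_mod_cast this
    rw [← h1]
    calc H.card * T = ∑ w ∈ H, T := by rw [Finset.sum_const, nsmul_eq_mul]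
      _ ≤ ∑ w ∈ H, (({e : M | w ∈ maskEnds M e} : Finset M).card : ℝ) :=
          Finset.sum_le_sum fun w hw => (Finset.mem_filter.1 hw).2.le
      _ ≤ _ := Finset.sum_le_sum_of_subset_of_nonneg (Finset.subset_univ _)
          fun _ _ _ => Nat.cast_nonneg _
  · set G : Finset M := {e : M | Disjoint (maskEnds M e) H}
    have hdeg : ∀ w, (({e ∈ G | w ∈ maskEnds M e} : Finset M).card : ℝ) ≤ T := by
      intro w
      by_cases hw : w ∈ H
      · rw [Finset.filter_eq_empty_iff.2]
        · simpa using hT.le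
        · exact fun e he hwe => Finset.disjoint_left.1 (Finset.mem_filter.1 he).2 hwe hw
      · have h1 : (({e : M | w ∈ maskEnds M e} : Finset M).card : ℝ) ≤ T :=
          not_lt.1 fun h => hw (Finset.mem_filter.2 ⟨Finset.mem_univ _, h⟩)
        refine le_trans ?_ h1
        exact_mod_cast Finset.card_le_card
          (Finset.filter_subset_filter _ (Finset.subset_univ _))
    refine (sum_pow_card_span_edgeSets_le (maskEnds_injective M) (card_maskEnds M)
      (sq_nonneg _) hl hD hdeg hqT).trans ?_
    refine sub_le_sub_right (Real.exp_le_exp.2 ?_) _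
    refine mul_le_mul_of_nonneg_right ?_ (sq_nonneg _)
    have := Finset.card_le_univ G
    rw [Fintype.card_coe] at this
    exact_mod_cast this

end LowerBound

/-! ### Clique sizes of polynomial order -/

theorem tendsto_const_mul_natCast_rpow_neg (C : ℝ) {a : ℝ} (ha : a < 0) :
    Tendsto (fun n : ℕ => C * (n : ℝ) ^ a) atTop (nhds 0) := by
  have h := (tendsto_rpow_neg_atTop (neg_pos.2 ha)).comp tendsto_natCast_atTop_atTop
  simpa using h.const_mul C

theorem eventually_div_le_of_isBigO {k : ℕ → ℕ} {δ : ℝ}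
    (hk : (fun n => (k n : ℝ)) =O[atTop] fun n : ℕ => (n : ℝ) ^ (1 / 2 + δ)) :
    ∃ C > 0, ∀ᶠ n : ℕ in atTop, (k n : ℝ) / n ≤ C * (n : ℝ) ^ (-(1 / 2 - δ)) := by
  obtain ⟨C, hC, h⟩ := hk.exists_pos
  refine ⟨C, hC, ?_⟩
  filter_upwards [h.bound, eventually_gt_atTop 0] with n hn hn0
  have hn0' : (0 : ℝ) < n := by exact_mod_cast hn0
  rw [Real.norm_of_nonneg (by positivity), Real.norm_of_nonneg (by positivity)] at hn
  rwa [div_le_iff₀ hn0', mul_assoc, ← Real.rpow_add_one hn0'.ne',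
    show -(1 / 2 - δ) + 1 = 1 / 2 + δ by ring]

theorem eventually_le_of_isBigO {k : ℕ → ℕ} {δ : ℝ} (hδ : δ < 1 / 2)
    (hk : (fun n => (k n : ℝ)) =O[atTop] fun n : ℕ => (n : ℝ) ^ (1 / 2 + δ)) :
    ∀ᶠ n : ℕ in atTop, k n ≤ n := by
  obtain ⟨C, -, hC⟩ := eventually_div_le_of_isBigO hk
  have h := tendsto_const_mul_natCast_rpow_neg C (a := -(1 / 2 - δ)) (by linarith)
  filter_upwards [hC, h.eventually_le_const one_pos, eventually_gt_atTop 0] with n h1 h2 h0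
  have hn0 : (0 : ℝ) < n := by exact_mod_cast h0
  have := (div_le_one hn0).1 (h1.trans h2)
  exact_mod_cast this

/-- Weak separation bounds the deviation by C times a nonzero gap, which is impossible once κ < 1/C.
-/
theorem not_weaklySeparates_of_tendsto {ι : ℕ → Type} {P Q : ∀ n, Measure (ι n → ℝ)}
    {f : ∀ n, MvPolynomial (ι n) ℝ} {κ : ℕ → ℝ} (hκ : Tendsto κ atTop (nhds 0))
    (h : ∀ᶠ n in atTop, meanGap (P n) (Q n) (f n) ≤ κ n * maxStd (P n) (Q n) (f n)) :
    ¬ WeaklySeparates P Q f := by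
  rintro ⟨hne, hO⟩
  obtain ⟨C, hC, hb⟩ := hO.exists_pos
  obtain ⟨n, h1, h2, h3, h4⟩ := (h.and (hne.and (hb.bound.and
    (hκ.eventually_lt_const (inv_pos.2 hC))))).exists
  have hg : 0 < meanGap (P n) (Q n) (f n) := lt_of_le_of_ne (abs_nonneg _) h2.symm
  have hs : 0 ≤ maxStd (P n) (Q n) (f n) := Real.sqrt_nonneg _
  rw [Real.norm_of_nonneg hs, Real.norm_of_nonneg hg.le] at h3
  have hs' : 0 < maxStd (P n) (Q n) (f n) := by
    rcases hs.eq_or_lt with h | h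
    · rw [← h, mul_zero] at h1
      linarith
    · exact h
  have h5 : meanGap (P n) (Q n) (f n) < C⁻¹ * maxStd (P n) (Q n) (f n) :=
    h1.trans_lt (mul_lt_mul_of_pos_right h4 hs')
  rw [inv_mul_eq_div, lt_div_iff₀ hC, mul_comm] at h5
  linarith

theorem not_weaklySeparates_of_card_mask {δ γ : ℝ} (hδ : δ < 1 / 2) (hγ : γ < 3 * (1 / 2 - δ))
    {k : ℕ → ℕ} (hk : (fun n => (k n : ℝ)) =O[atTop] fun n : ℕ => (n : ℝ) ^ (1 / 2 + δ))
    {M : ∀ n, Mask n} (hM : (fun n => ((M n).card : ℝ)) =O[atTop] fun n : ℕ => (n : ℝ) ^ γ)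
    {f : ∀ n, MvPolynomial (M n) ℝ}
    (hf : (fun n => ((f n).totalDegree : ℝ)) =o[atTop] fun n : ℕ => Real.log n ^ 2) :
    ¬ WeaklySeparates (fun n => maskedPlanted (k n) (M n)) (fun n => maskedNull (M n)) f := by
  obtain ⟨ε, rfl⟩ : ∃ ε, δ = 1 / 2 - ε := ⟨1 / 2 - δ, by ring⟩
  have hε : 0 < ε := by linarith
  obtain ⟨C, hC0, hC⟩ := eventually_div_le_of_isBigO hk
  have hkn := eventually_le_of_isBigO hδ hk
  rw [show 1 / 2 - (1 / 2 - ε) = ε by ring] at hC hγ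
  obtain ⟨B, hB0, hB⟩ := hM.exists_pos
  -- Half the slack below the threshold. With T = n^(2ε-η) and l = (η/4) log n, so that exp(2l) =
  -- n^(η/2), the three quantities estimated next are of order at most n^(-η), n^(-η/2) and
  -- n^(-(ε+η)).
  obtain ⟨η, hη⟩ : ∃ η, η = (3 * ε - γ) / 2 := ⟨_, rfl⟩
  have hη0 : 0 < η := by rw [hη]; linarith
  have hγη : γ = 3 * ε - 2 * η := by rw [hη]; ring
  have hexp : ∀ n : ℕ, 0 < n → Real.exp (2 * (η / 4 * Real.log n)) = (n : ℝ) ^ (η / 2) := by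
    intro n hn
    rw [Real.rpow_def_of_pos (by exact_mod_cast hn)]
    congr 1
    ring
  have hρ : ∀ᶠ n : ℕ in atTop, 2 * (M n).card / (n : ℝ) ^ (2 * ε - η) * ((k n : ℝ) / n) ≤
      2 * B * C * (n : ℝ) ^ (-η) := by
    filter_upwards [hB.bound, hC, eventually_gt_atTop 0] with n h1 h2 h0
    have hn0 : (0 : ℝ) < n := by exact_mod_cast h0
    rw [Real.norm_of_nonneg (Nat.cast_nonneg _), Real.norm_of_nonneg (by positivity)] at h1
    calc _ ≤ 2 * (B * (n : ℝ) ^ γ) / (n : ℝ) ^ (2 * ε - η) * (C * (n : ℝ) ^ (-ε)) := by gcongr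
      _ = 2 * B * C * ((n : ℝ) ^ γ / (n : ℝ) ^ (2 * ε - η) * (n : ℝ) ^ (-ε)) := by ring
      _ = _ := by
        rw [← Real.rpow_sub hn0, ← Real.rpow_add hn0]
        congr 2
        rw [hγη]; ring
  have hqT : ∀ᶠ n : ℕ in atTop, ((k n : ℝ) / n) ^ 2 * Real.exp (2 * (η / 4 * Real.log n)) *
      (n : ℝ) ^ (2 * ε - η) ≤ C ^ 2 * (n : ℝ) ^ (-(η / 2)) := by
    filter_upwards [hC, eventually_gt_atTop 0] with n h2 h0
    have hn0 : (0 : ℝ) < n := by exact_mod_cast h0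
    rw [hexp n h0]
    calc _ ≤ (C * (n : ℝ) ^ (-ε)) ^ 2 * (n : ℝ) ^ (η / 2) * (n : ℝ) ^ (2 * ε - η) := by gcongr
      _ = C ^ 2 * ((n : ℝ) ^ (-ε) * (n : ℝ) ^ (-ε) * (n : ℝ) ^ (η / 2) *
          (n : ℝ) ^ (2 * ε - η)) := by ring
      _ = _ := by
        rw [← Real.rpow_add hn0, ← Real.rpow_add hn0, ← Real.rpow_add hn0]
        congr 2
        ring
  have hx : ∀ᶠ n : ℕ in atTop, (M n).card * (((k n : ℝ) / n) ^ 2 *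
      Real.exp (2 * (η / 4 * Real.log n)) * Real.exp 1) ^ 2 ≤
      B * C ^ 4 * Real.exp 1 ^ 2 * (n : ℝ) ^ (-(ε + η)) := by
    filter_upwards [hB.bound, hC, eventually_gt_atTop 0] with n h1 h2 h0
    have hn0 : (0 : ℝ) < n := by exact_mod_cast h0
    rw [Real.norm_of_nonneg (Nat.cast_nonneg _), Real.norm_of_nonneg (by positivity)] at h1
    rw [hexp n h0]
    calc _ ≤ (B * (n : ℝ) ^ γ) * ((C * (n : ℝ) ^ (-ε)) ^ 2 * (n : ℝ) ^ (η / 2) *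
          Real.exp 1) ^ 2 := by gcongr
      _ = B * C ^ 4 * Real.exp 1 ^ 2 * ((n : ℝ) ^ γ * (n : ℝ) ^ (-ε) * (n : ℝ) ^ (-ε) *
          (n : ℝ) ^ (-ε) * (n : ℝ) ^ (-ε) * (n : ℝ) ^ (η / 2) * (n : ℝ) ^ (η / 2)) := by ring
      _ = _ := by
        simp only [← Real.rpow_add hn0]
        congr 2
        rw [hγη]; ring
  have hρ0 := tendsto_const_mul_natCast_rpow_neg (2 * B * C) (neg_lt_zero.2 hη0)
  have hqT0 := tendsto_const_mul_natCast_rpow_neg (C ^ 2) (neg_lt_zero.2 (half_pos hη0))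
  have hx0 := tendsto_const_mul_natCast_rpow_neg (B * C ^ 4 * Real.exp 1 ^ 2)
    (neg_lt_zero.2 (add_pos hε hη0))
  have hρlim := squeeze_zero' (Eventually.of_forall fun n => mul_nonneg
    (div_nonneg (mul_nonneg zero_le_two (Nat.cast_nonneg _)) (by positivity)) (by positivity)) hρ hρ0
  have hxlim := squeeze_zero' (Eventually.of_forall fun n => mul_nonneg
    (Nat.cast_nonneg _) (sq_nonneg _)) hx hx0
  have hlim : Tendsto (fun n : ℕ =>
      2 * (√(2 * (M n).card / (n : ℝ) ^ (2 * ε - η) * ((k n : ℝ) / n)) +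
        √(Real.exp ((M n).card * (((k n : ℝ) / n) ^ 2 *
          Real.exp (2 * (η / 4 * Real.log n)) * Real.exp 1) ^ 2) - 1))) atTop (nhds 0) := by
    have h := ((hρlim.sqrt).add (((Real.continuous_exp.tendsto 0).comp hxlim).sub_const
      1).sqrt).const_mul 2
    simpa using h
  refine not_weaklySeparates_of_tendsto hlim ?_
  filter_upwards [hkn, hρ, hqT, hρ0.eventually_le_const (half_pos one_pos),
    hqT0.eventually_le_const one_pos, hf.bound (c := (η / 4) ^ 2) (by positivity),
    eventually_gt_atTop 1] with n h1 h2 h3 h4 h5 h6 h7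
  have hn0 : (0 : ℝ) < n := by exact_mod_cast (zero_lt_one.trans h7)
  refine meanGap_le h1 (f n) (by positivity) ?_ ?_ (h3.trans h5) (h2.trans h4)
  · exact mul_pos (by positivity) (Real.log_pos (by exact_mod_cast h7))
  · rw [Real.norm_of_nonneg (by positivity), Real.norm_of_nonneg (by positivity)] at h6
    rwa [mul_pow]

/-! ### The block statistic on a rectangular mask -/

theorem card_rectMask_le {n : ℕ} (A B : Finset (Fin n)) :
    (rectMask A B).card ≤ A.card * B.card := by
  rw [← Finset.card_product, ← Finset.card_map (Function.Embedding.subtype _)]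
  refine (Finset.card_le_card (t := (A ×ˢ B).image fun z => s(z.1, z.2)) ?_).trans
    Finset.card_image_le
  intro e he
  obtain ⟨e', he', rfl⟩ := Finset.mem_map.1 he
  obtain ⟨a, ha, b, hb, h⟩ := (Finset.mem_filter.1 he').2
  exact Finset.mem_image.2 ⟨(a, b), Finset.mk_mem_product ha hb, h.symm⟩

section Block

variable {n r t s : ℕ} (φ : Fin r ⊕ (Fin t × Fin s) ↪ Fin n)

/-- The left side of the rectangle. -/
def blockLeft : Finset (Fin n) := Finset.univ.map (Function.Embedding.inl.trans φ)

/-- The right side of the rectangle: `t` blocks of `s` vertices. -/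
def blockRight : Finset (Fin n) := Finset.univ.map (Function.Embedding.inr.trans φ)

theorem disjoint_blockLeft_blockRight : Disjoint (blockLeft φ) (blockRight φ) := by
  rw [Finset.disjoint_left]
  intro v hv hv'
  obtain ⟨a, -, rfl⟩ := Finset.mem_map.1 hv
  obtain ⟨z, -, h⟩ := Finset.mem_map.1 hv'
  exact Sum.inr_ne_inl (φ.injective h)

/-- The mask of the block statistic. -/
abbrev blockMask : Mask n := rectMask (blockLeft φ) (blockRight φ)

/-- The edge of the rectangle between two vertices. -/
def blockEdge (a : Fin r) (z : Fin t × Fin s) : blockMask φ :=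
  ⟨⟨s(φ (Sum.inl a), φ (Sum.inr z)), fun h => Sum.inl_ne_inr (φ.injective (Sym2.mk_isDiag_iff.1 h))⟩,
    Finset.mem_filter.2 ⟨Finset.mem_univ _, φ (Sum.inl a),
      Finset.mem_map.2 ⟨a, Finset.mem_univ _, rfl⟩, φ (Sum.inr z),
      Finset.mem_map.2 ⟨z, Finset.mem_univ _, rfl⟩, rfl⟩⟩

theorem blockEdge_inj {a a' : Fin r} {z z' : Fin t × Fin s} :
    blockEdge φ a z = blockEdge φ a' z' ↔ a = a' ∧ z = z' := by
  refine ⟨fun h => ?_, fun h => by rw [h.1, h.2]⟩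
  have h1 : s(φ (Sum.inl a), φ (Sum.inr z)) = s(φ (Sum.inl a'), φ (Sum.inr z')) :=
    congrArg (fun e => e.1.1) h
  simpa using h1

theorem maskEnds_blockEdge (a : Fin r) (z : Fin t × Fin s) :
    maskEnds (blockMask φ) (blockEdge φ a z) = {φ (Sum.inl a), φ (Sum.inr z)} := by
  ext v
  simp [maskEnds, blockEdge]

/-- The star from a vertex on the left to one vertex in each block on the right. -/
def blockStar (j : Fin r × (Fin t → Fin s)) : Finset (blockMask φ) :=
  Finset.univ.image fun i => blockEdge φ j.1 (i, j.2 i)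

theorem blockEdge_mem_blockStar {a : Fin r} {z : Fin t × Fin s}
    {j : Fin r × (Fin t → Fin s)} :
    blockEdge φ a z ∈ blockStar φ j ↔ a = j.1 ∧ z.2 = j.2 z.1 := by
  simp only [blockStar, Finset.mem_image, Finset.mem_univ, true_and, blockEdge_inj]
  constructor
  · rintro ⟨i, h, rfl⟩
    exact ⟨h.symm, rfl⟩
  · rintro ⟨h, h'⟩
    exact ⟨z.1, h.symm, by rw [← h']⟩

/-- The sum over all stars of the product of their edges. -/
noncomputable def blockPoly : MvPolynomial (blockMask φ) ℝ :=
  ∑ j : Fin r × (Fin t → Fin s), ∏ i, MvPolynomial.X (blockEdge φ j.1 (i, j.2 i))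

theorem totalDegree_blockPoly_le : (blockPoly φ).totalDegree ≤ t := by
  refine MvPolynomial.totalDegree_finsetSum_le fun j _ => ?_
  refine (MvPolynomial.totalDegree_finsetProd _ _).trans ?_
  simp

theorem eval_blockPoly (y : blockMask φ → ℝ) :
    MvPolynomial.eval y (blockPoly φ) = ∑ j, ∏ e ∈ blockStar φ j, y e := by
  rw [blockPoly, map_sum]
  refine Finset.sum_congr rfl fun j _ => ?_
  rw [blockStar, Finset.prod_image, MvPolynomial.eval_prod]
  · simp
  · intro i _ i' _ h
    exact congrArg Prod.fst ((blockEdge_inj φ).1 h).2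

/-- Both ends of all edges in a set of edges lie in `K`. -/
noncomputable def spanIndicator {M : Mask n} (S : Finset M) (K : Finset (Fin n)) : ℝ :=
  if S.biUnion (maskEnds M) ⊆ K then 1 else 0

theorem cliqueMean_blockPoly (K : Finset (Fin n)) :
    cliqueMean (blockMask φ) K (blockPoly φ) = ∑ j, spanIndicator (blockStar φ j) K := by
  rw [cliqueMean]
  have h : ∀ y : VertexPair n → ℝ,
      MvPolynomial.eval ((blockMask φ).restrict y) (blockPoly φ) =
      ∑ j, (∏ e ∈ blockStar φ j, (blockMask φ).restrict y e) *
        ∏ e ∈ (∅ : Finset (blockMask φ)), (blockMask φ).restrict y e := by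
    intro y
    simp [eval_blockPoly]
  simp only [h]
  rw [integral_finsetSum _ fun j _ => integrable_restrict_prod_mul_prod _ K _ _]
  refine Finset.sum_congr rfl fun j _ => ?_
  rw [integral_restrict_prod_mul_prod, ← Finset.bot_eq_empty, symmDiff_bot, spanIndicator]

theorem cliqueMean_blockPoly_mul_self (K : Finset (Fin n)) :
    cliqueMean (blockMask φ) K (blockPoly φ * blockPoly φ) =
      ∑ j, ∑ j', spanIndicator (symmDiff (blockStar φ j) (blockStar φ j')) K := by
  rw [cliqueMean]
  simp only [map_mul, eval_blockPoly, Finset.sum_mul_sum]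
  rw [integral_finsetSum _ fun j _ => integrable_finsetSum _ fun j' _ =>
    integrable_restrict_prod_mul_prod _ K _ _]
  refine Finset.sum_congr rfl fun j _ => ?_
  rw [integral_finsetSum _ fun j' _ => integrable_restrict_prod_mul_prod _ K _ _]
  exact Finset.sum_congr rfl fun j' _ => integral_restrict_prod_mul_prod _ K _ _

theorem cliqueMean_empty_blockPoly (ht : 0 < t) :
    cliqueMean (blockMask φ) ∅ (blockPoly φ) = 0 := by
  rw [cliqueMean_blockPoly]
  refine Finset.sum_eq_zero fun j _ => if_neg fun h => ?_
  have := biUnion_maskEnds_subset_empty.1 h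
  rw [blockStar, Finset.image_eq_empty, Finset.univ_eq_empty_iff] at this
  exact this.elim ⟨0, ht⟩

theorem blockStar_injective (ht : 0 < t) : Function.Injective (blockStar φ) := by
  intro j j' h
  have h1 : ∀ i, j.1 = j'.1 ∧ j.2 i = j'.2 i := fun i => by
    have : blockEdge φ j.1 (i, j.2 i) ∈ blockStar φ j' := by
      rw [← h, blockEdge_mem_blockStar]
      exact ⟨rfl, rfl⟩
    exact (blockEdge_mem_blockStar φ).1 this
  exact Prod.ext (h1 ⟨0, ht⟩).1 (funext fun i => (h1 i).2)

/-- Distinct stars are orthogonal under the null law, so only the number of stars remains. -/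
theorem cliqueMean_empty_blockPoly_mul_self (ht : 0 < t) :
    cliqueMean (blockMask φ) ∅ (blockPoly φ * blockPoly φ) = r * s ^ t := by
  rw [cliqueMean_blockPoly_mul_self]
  have : ∀ j j', spanIndicator (symmDiff (blockStar φ j) (blockStar φ j')) ∅ =
      if j = j' then 1 else 0 := by
    intro j j'
    rw [spanIndicator]
    refine if_congr ?_ rfl rfl
    rw [biUnion_maskEnds_subset_empty, ← Finset.bot_eq_empty, symmDiff_eq_bot,
      (blockStar_injective φ ht).eq_iff]
  simp only [this, Finset.sum_ite_eq, Finset.mem_univ, if_true]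
  simp

theorem le_cliqueAvg_spanIndicator_blockStar {k : ℕ} (hk : k ≤ n) (hkt : t + 1 ≤ k)
    (j : Fin r × (Fin t → Fin s)) :
    (((k : ℝ) - (t + 1 : ℕ)) / n) ^ (t + 1) ≤ cliqueAvg n k (spanIndicator (blockStar φ j)) := by
  set U : Finset (Fin n) := (Finset.disjSum {j.1}
    (Finset.univ.map ⟨fun i : Fin t => (i, j.2 i), fun i i' h => congrArg Prod.fst h⟩)).map φ
  have hU : U.card = t + 1 := by simp [U, add_comm]
  have h := le_cliqueAvg_subset hk U (hU.trans_le hkt)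
  rw [hU] at h
  refine h.trans (cliqueAvg_mono fun K => ?_)
  rw [spanIndicator]
  split_ifs with h1 h2
  · exact le_rfl
  · refine absurd (Finset.Subset.trans ?_ h1) h2
    refine Finset.biUnion_subset.2 fun e he => ?_
    obtain ⟨i, -, rfl⟩ := Finset.mem_image.1 he
    rw [maskEnds_blockEdge]
    intro v hv
    rcases Finset.mem_insert.1 hv with rfl | hv
    · simp [U]
    · rw [Finset.mem_singleton.1 hv]
      refine Finset.mem_map_of_mem _ (Finset.inr_mem_disjSum.2 ?_)
      exact Finset.mem_map_of_mem _ (Finset.mem_univ i)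
  · exact zero_le_one
  · exact le_rfl

/-- Vertices that lie on an edge of exactly one of the two stars. -/
def pairVertices (j j' : Fin r × (Fin t → Fin s)) : Finset (Fin r ⊕ (Fin t × Fin s)) :=
  if j.1 = j'.1 then
    if j.2 = j'.2 then ∅ else
      Finset.disjSum {j.1} {z | j.2 z.1 ≠ j'.2 z.1 ∧ (z.2 = j.2 z.1 ∨ z.2 = j'.2 z.1)}
  else Finset.disjSum {j.1, j'.1} {z | z.2 = j.2 z.1 ∨ z.2 = j'.2 z.1}

theorem mem_span_of_blockEdge {S : Finset (blockMask φ)} {a : Fin r} {z : Fin t × Fin s}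
    (h : blockEdge φ a z ∈ S) : φ (Sum.inl a) ∈ S.biUnion (maskEnds (blockMask φ)) ∧
      φ (Sum.inr z) ∈ S.biUnion (maskEnds (blockMask φ)) := by
  constructor <;> refine Finset.mem_biUnion.2 ⟨_, h, ?_⟩ <;> simp [maskEnds_blockEdge]

/-- Two stars share an edge only if they have the same centre and the same leaf in some block: with
distinct centres nothing cancels, with a common centre exactly the agreeing leaves drop out. An
inclusion is enough, since it bounds the probability that K contains the span from above. -/
theorem map_pairVertices_subset (ht : 0 < t) (j j' : Fin r × (Fin t → Fin s)) :
    (pairVertices j j').map φ ⊆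
      (symmDiff (blockStar φ j) (blockStar φ j')).biUnion (maskEnds (blockMask φ)) := by
  have hl : ∀ i, ¬ (j.1 = j'.1 ∧ j.2 i = j'.2 i) → blockEdge φ j.1 (i, j.2 i) ∈
      symmDiff (blockStar φ j) (blockStar φ j') := by
    intro i hi
    rw [Finset.mem_symmDiff, blockEdge_mem_blockStar, blockEdge_mem_blockStar]
    exact Or.inl ⟨⟨rfl, rfl⟩, hi⟩
  have hr : ∀ i, ¬ (j.1 = j'.1 ∧ j.2 i = j'.2 i) → blockEdge φ j'.1 (i, j'.2 i) ∈
      symmDiff (blockStar φ j) (blockStar φ j') := by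
    intro i hi
    rw [Finset.mem_symmDiff, blockEdge_mem_blockStar, blockEdge_mem_blockStar]
    exact Or.inr ⟨⟨rfl, rfl⟩, fun h => hi ⟨h.1.symm, h.2.symm⟩⟩
  intro v hv
  obtain ⟨u, hu, rfl⟩ := Finset.mem_map.1 hv
  rw [pairVertices] at hu
  split_ifs at hu with h1 h2
  · simp at hu
  · obtain ⟨i, hi⟩ := Function.ne_iff.1 h2
    rcases u with a | ⟨i', b⟩
    · rw [Finset.inl_mem_disjSum, Finset.mem_singleton] at hu
      subst hu
      exact (mem_span_of_blockEdge φ (hl i fun h => hi h.2)).1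
    · rw [Finset.inr_mem_disjSum, Finset.mem_filter] at hu
      dsimp only at hu
      obtain ⟨-, hne, rfl | rfl⟩ := hu
      · exact (mem_span_of_blockEdge φ (hl i' fun h => hne h.2)).2
      · exact (mem_span_of_blockEdge φ (hr i' fun h => hne h.2)).2
  · rcases u with a | ⟨i', b⟩
    · rw [Finset.inl_mem_disjSum, Finset.mem_insert, Finset.mem_singleton] at hu
      rcases hu with rfl | rfl
      · exact (mem_span_of_blockEdge φ (hl ⟨0, ht⟩ fun h => h1 h.1)).1
      · exact (mem_span_of_blockEdge φ (hr ⟨0, ht⟩ fun h => h1 h.1)).1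
    · rw [Finset.inr_mem_disjSum, Finset.mem_filter] at hu
      dsimp only at hu
      obtain ⟨-, rfl | rfl⟩ := hu
      · exact (mem_span_of_blockEdge φ (hl i' fun h => h1 h.1)).2
      · exact (mem_span_of_blockEdge φ (hr i' fun h => h1 h.1)).2

theorem pow_card_filter_prod (p : ℝ) (q : Fin t × Fin s → Prop) [DecidablePred q] :
    p ^ (Finset.univ.filter q).card = ∏ i, p ^ (Finset.univ.filter fun b => q (i, b)).card := by
  rw [Finset.prod_pow_eq_pow_sum]
  congr 1
  simp only [Finset.card_filter]
  rw [Fintype.sum_prod_type]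

theorem card_filter_eq_or {α : Type*} [Fintype α] [DecidableEq α] (x x' : α) :
    (Finset.univ.filter fun b => b = x ∨ b = x').card = if x = x' then 1 else 2 := by
  have : (Finset.univ.filter fun b => b = x ∨ b = x') = {x, x'} := by ext; simp
  rw [this]
  split_ifs with h
  · simp [h]
  · exact Finset.card_pair h

/-- The weight factors over blocks. The first term is exact for distinct centres and is kept for
equal ones, so that centres can be summed freely; the other two treat a common centre, where an
agreeing block costs nothing, and identical stars. -/
theorem pow_card_pairVertices_le {p : ℝ} (hp : 0 ≤ p) (j j' : Fin r × (Fin t → Fin s)) :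
    p ^ (pairVertices j j').card ≤
      p ^ 2 * (∏ i, if j.2 i = j'.2 i then p else p ^ 2) +
      if j.1 = j'.1 then p * (∏ i, if j.2 i = j'.2 i then 1 else p ^ 2) +
        (if j.2 = j'.2 then 1 else 0) else 0 := by
  have hA : 0 ≤ p ^ 2 * (∏ i, if j.2 i = j'.2 i then p else p ^ 2) :=
    mul_nonneg (by positivity) (Finset.prod_nonneg fun i _ => by split_ifs <;> positivity)
  have hB : 0 ≤ p * (∏ i, if j.2 i = j'.2 i then 1 else p ^ 2) :=
    mul_nonneg hp (Finset.prod_nonneg fun i _ => by split_ifs <;> positivity)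
  rw [pairVertices]
  split_ifs with h1 h2
  · rw [Finset.card_empty, pow_zero]
    linarith
  · rw [add_zero, Finset.card_disjSum, pow_add, Finset.card_singleton, pow_one,
      pow_card_filter_prod]
    refine le_add_of_nonneg_of_le hA (le_of_eq ?_)
    congr 1
    refine Finset.prod_congr rfl fun i _ => ?_
    by_cases h : j.2 i = j'.2 i
    · simp [h]
    · simp only [ne_eq, h, not_false_eq_true, true_and, if_false, card_filter_eq_or]
  · rw [add_zero, Finset.card_disjSum, pow_add, Finset.card_pair h1, pow_card_filter_prod]
    refine le_of_eq ?_
    congr 1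
    refine Finset.prod_congr rfl fun i _ => ?_
    dsimp only
    rw [card_filter_eq_or]
    split_ifs <;> simp

/-- For fixed τ the sum over τ' is a product over blocks, each factor having one agreeing leaf and
fewer than s others. -/
theorem sum_sum_prod_ite_le {x y : ℝ} (hx : 0 ≤ x) (hy : 0 ≤ y) :
    ∑ τ : Fin t → Fin s, ∑ τ' : Fin t → Fin s, (∏ i, if τ i = τ' i then x else y) ≤
      (s : ℝ) ^ t * (x + s * y) ^ t := by
  have h : ∀ τ : Fin t → Fin s, ∑ τ' : Fin t → Fin s, (∏ i, if τ i = τ' i then x else y) ≤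
      (x + s * y) ^ t := by
    intro τ
    have h1 := Finset.prod_univ_sum (fun _ : Fin t => (Finset.univ : Finset (Fin s)))
      (fun i b => if τ i = b then x else y)
    rw [Fintype.piFinset_univ] at h1
    rw [← h1]
    have h2 : ∀ i : Fin t, ∑ b, (if τ i = b then x else y) ≤ x + s * y := by
      intro i
      calc ∑ b, (if τ i = b then x else y) ≤ ∑ b, ((if τ i = b then x else 0) + y) :=
            Finset.sum_le_sum fun b _ => by split_ifs <;> linarith
        _ = _ := by simp [Finset.sum_add_distrib]
    refine (Finset.prod_le_prod (fun i _ => Finset.sum_nonneg fun b _ => ?_)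
      fun i _ => h2 i).trans (by simp)
    split_ifs <;> assumption
  refine (Finset.sum_le_sum fun τ _ => h τ).trans (le_of_eq ?_)
  simp

theorem cliqueAvg_cliqueMean_blockPoly_mul_self_le (ht : 0 < t) {k : ℕ} (hk : k ≤ n) {p : ℝ}
    (hp : p = (k : ℝ) / n) :
    (cliqueAvg n k fun K => cliqueMean (blockMask φ) K (blockPoly φ * blockPoly φ)) ≤
      r ^ 2 * p ^ 2 * (s ^ t * (p + s * p ^ 2) ^ t) +
        (r * p * (s ^ t * (1 + s * p ^ 2) ^ t) + r * s ^ t) := by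
  have hp0 : 0 ≤ p := by rw [hp]; positivity
  have hpair : ∀ j j', cliqueAvg n k
      (spanIndicator (symmDiff (blockStar φ j) (blockStar φ j'))) ≤
      p ^ 2 * (∏ i, if j.2 i = j'.2 i then p else p ^ 2) +
      if j.1 = j'.1 then p * (∏ i, if j.2 i = j'.2 i then 1 else p ^ 2) +
        (if j.2 = j'.2 then 1 else 0) else 0 := by
    intro j j'
    refine le_trans ?_ (pow_card_pairVertices_le hp0 j j')
    have h := cliqueAvg_subset_le hk ((pairVertices j j').map φ)
    rw [Finset.card_map, ← hp] at h
    refine le_trans (cliqueAvg_mono fun K => ?_) h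
    rw [spanIndicator]
    split_ifs with h1 h2
    · exact le_rfl
    · exact absurd ((map_pairVertices_subset φ ht j j').trans h1) h2
    · exact zero_le_one
    · exact le_rfl
  simp only [cliqueMean_blockPoly_mul_self]
  rw [cliqueAvg_sum]
  simp only [cliqueAvg_sum]
  refine (Finset.sum_le_sum fun j _ => Finset.sum_le_sum fun j' _ => hpair j j').trans ?_
  simp only [Finset.sum_add_distrib, Fintype.sum_prod_type]
  refine add_le_add ?_ ?_
  · calc ∑ _a : Fin r, ∑ τ : Fin t → Fin s, ∑ _a' : Fin r, ∑ τ' : Fin t → Fin s,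
            p ^ 2 * (∏ i, if τ i = τ' i then p else p ^ 2)
        = r ^ 2 * p ^ 2 * ∑ τ : Fin t → Fin s, ∑ τ' : Fin t → Fin s,
          (∏ i, if τ i = τ' i then p else p ^ 2) := by
          simp only [Finset.sum_const, Finset.card_univ, Fintype.card_fin, nsmul_eq_mul]
          simp only [← Finset.mul_sum]
          ring
      _ ≤ _ := by
          gcongr
          exact sum_sum_prod_ite_le hp0 (by positivity)
  · calc _ = r * p * ∑ τ : Fin t → Fin s, ∑ τ' : Fin t → Fin s,
          (∏ i, if τ i = τ' i then 1 else p ^ 2) + r * s ^ t := by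
          have : ∀ (a : Fin r) (τ : Fin t → Fin s), (∑ a' : Fin r, ∑ τ' : Fin t → Fin s,
              if a = a' then p * (∏ i, if τ i = τ' i then 1 else p ^ 2) +
                (if τ = τ' then 1 else 0) else 0) =
              p * (∑ τ' : Fin t → Fin s, (∏ i, if τ i = τ' i then 1 else p ^ 2)) + 1 := by
            intro a τ
            rw [Finset.sum_comm]
            simp [Finset.sum_add_distrib, Finset.mul_sum]
          simp only [this]
          simp only [Finset.sum_add_distrib, ← Finset.mul_sum, Finset.sum_const, Finset.card_univ,
            Fintype.card_fin, Fintype.card_pi, nsmul_eq_mul, Finset.prod_const]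
          push_cast
          ring
      _ ≤ _ := by
          gcongr
          exact sum_sum_prod_ite_le zero_le_one (by positivity)

end Block

/-- The relative second moment of the block statistic under the planted law. -/
noncomputable def blockMoment (r s p : ℝ) (t : ℕ) : ℝ :=
  (1 + 1 / (s * p)) ^ t + (1 / (r * p) * (1 + 1 / (s * p ^ 2)) ^ t +
    1 / (r * p ^ 2 * (s * p ^ 2) ^ t))

/-- An upper bound for the squared ratio of the standard deviation to the gap of the means. -/
noncomputable def blockRatio (r s p k : ℝ) (t : ℕ) : ℝ :=
  max (blockMoment r s p t / ((1 - (t + 1 : ℕ) / k) ^ (t + 1)) ^ 2 - 1)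
    (1 / (r * p ^ 2 * (s * p ^ 2) ^ t) / ((1 - (t + 1 : ℕ) / k) ^ (t + 1)) ^ 2)

theorem separation_blockPoly {n r t s k : ℕ} (φ : Fin r ⊕ (Fin t × Fin s) ↪ Fin n) (ht : 0 < t)
    (hr : 0 < r) (hs : 0 < s) (hk : k ≤ n) (hkt : t + 1 < k) :
    0 < meanGap (maskedPlanted k (blockMask φ)) (maskedNull (blockMask φ)) (blockPoly φ) ∧
    maxStd (maskedPlanted k (blockMask φ)) (maskedNull (blockMask φ)) (blockPoly φ) ≤
      √(blockRatio r s (k / n) k t) *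
        meanGap (maskedPlanted k (blockMask φ)) (maskedNull (blockMask φ)) (blockPoly φ) := by
  have hk0 : (0 : ℝ) < k := by exact_mod_cast (Nat.zero_lt_succ t).trans hkt
  have hn0 : (0 : ℝ) < n := hk0.trans_le (by exact_mod_cast hk)
  have hr0 : (0 : ℝ) < r := by exact_mod_cast hr
  have hs0 : (0 : ℝ) < s := by exact_mod_cast hs
  obtain ⟨p, hp⟩ : ∃ p : ℝ, p = (k : ℝ) / n := ⟨_, rfl⟩
  have hp0 : 0 < p := by rw [hp]; positivity
  rw [← hp]
  set μ := cliqueAvg n k fun K => cliqueMean (blockMask φ) K (blockPoly φ) with hμ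
  -- A lower bound for the relative loss from sampling the clique without replacement; G below is
  -- the planted mean for independent sampling with rate p.
  set θ : ℝ := (1 - (t + 1 : ℕ) / k) ^ (t + 1) with hθ
  have hθ0 : 0 < θ := by
    refine pow_pos (sub_pos.2 ((div_lt_one hk0).2 ?_)) _
    exact_mod_cast hkt
  set G : ℝ := r * s ^ t * p ^ (t + 1) with hG
  have hG0 : 0 < G := by positivity
  have hμG : G * θ ≤ μ := by
    have h : ∀ j, p ^ (t + 1) * θ ≤ cliqueAvg n k (spanIndicator (blockStar φ j)) := by
      intro j
      refine le_trans (le_of_eq ?_) (le_cliqueAvg_spanIndicator_blockStar φ hk hkt.le j)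
      rw [hθ, ← mul_pow, hp]
      congr 1
      field_simp
    simp only [hμ, cliqueMean_blockPoly]
    rw [cliqueAvg_sum]
    refine le_trans (le_of_eq ?_) (Finset.sum_le_sum fun j _ => h j)
    simp only [Finset.sum_const, Finset.card_univ, Fintype.card_prod, Fintype.card_fin,
      Fintype.card_pi, nsmul_eq_mul, Finset.prod_const]
    rw [hG]
    push_cast
    ring
  have hμ0 : 0 < μ := (mul_pos hG0 hθ0).trans_le hμG
  have hgap : meanGap (maskedPlanted k (blockMask φ)) (maskedNull (blockMask φ)) (blockPoly φ) =
      μ := by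
    rw [meanGap, integral_maskedPlanted, integral_maskedNull, cliqueMean_empty_blockPoly φ ht,
      sub_zero, abs_of_pos hμ0]
  have hG2 : G ^ 2 ≤ μ ^ 2 / θ ^ 2 := by
    rw [le_div_iff₀ (by positivity), ← mul_pow]
    gcongr
  rw [hgap]
  refine ⟨hμ0, ?_⟩
  have hthird : (r : ℝ) * s ^ t = G ^ 2 * (1 / (r * p ^ 2 * (s * p ^ 2) ^ t)) := by
    rw [hG]
    field_simp
    ring
  have hP : variance (fun y => MvPolynomial.eval y (blockPoly φ))
      (maskedPlanted k (blockMask φ)) ≤ blockRatio r s p k t * μ ^ 2 := by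
    rw [variance_maskedPlanted hk, ← hμ]
    have h1 := cliqueAvg_cliqueMean_blockPoly_mul_self_le φ ht hk hp
    -- Dividing the second moment by G² pulls a factor sp² out of each block and leaves the
    -- corrections in `blockMoment`.
    have h2 : (r : ℝ) ^ 2 * p ^ 2 * (s ^ t * (p + s * p ^ 2) ^ t) +
        (r * p * (s ^ t * (1 + s * p ^ 2) ^ t) + r * s ^ t) = G ^ 2 * blockMoment r s p t := by
      have e1 : p + s * p ^ 2 = s * p ^ 2 * (1 + 1 / (s * p)) := by field_simp; ring
      have e2 : 1 + s * p ^ 2 = s * p ^ 2 * (1 + 1 / (s * p ^ 2)) := by field_simp; ring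
      have e3 : (r : ℝ) * p * (s ^ t * (s * p ^ 2) ^ t) = G ^ 2 * (1 / (r * p)) := by
        rw [hG]; field_simp; ring
      have e4 : (r : ℝ) ^ 2 * p ^ 2 * (s ^ t * (s * p ^ 2) ^ t) = G ^ 2 := by
        rw [hG]; ring
      rw [blockMoment, hthird, e1, e2, mul_pow (s * p ^ 2), mul_pow (s * p ^ 2)]
      linear_combination (1 + 1 / (s * p)) ^ t * e4 + (1 + 1 / (s * p ^ 2)) ^ t * e3
    have hZ : 0 ≤ blockMoment r s p t := by rw [blockMoment]; positivity
    rw [h2] at h1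
    calc _ ≤ μ ^ 2 / θ ^ 2 * blockMoment r s p t - μ ^ 2 :=
          sub_le_sub_right (h1.trans (mul_le_mul_of_nonneg_right hG2 hZ)) _
      _ = (blockMoment r s p t / θ ^ 2 - 1) * μ ^ 2 := by ring
      _ ≤ _ := mul_le_mul_of_nonneg_right (le_max_left _ _) (sq_nonneg _)
  have hQ : variance (fun y => MvPolynomial.eval y (blockPoly φ))
      (maskedNull (blockMask φ)) ≤ blockRatio r s p k t * μ ^ 2 := by
    rw [variance_maskedNull, cliqueMean_empty_blockPoly φ ht,
      cliqueMean_empty_blockPoly_mul_self φ ht, hthird]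
    calc _ ≤ μ ^ 2 / θ ^ 2 * (1 / (r * p ^ 2 * (s * p ^ 2) ^ t)) := by
          rw [zero_pow two_ne_zero, sub_zero]
          exact mul_le_mul_of_nonneg_right hG2 (by positivity)
      _ = 1 / (r * p ^ 2 * (s * p ^ 2) ^ t) / θ ^ 2 * μ ^ 2 := by ring
      _ ≤ _ := mul_le_mul_of_nonneg_right (le_max_right _ _) (sq_nonneg _)
  calc _ ≤ √(blockRatio r s p k t * μ ^ 2) := Real.sqrt_le_sqrt (max_le hP hQ)
    _ = √(blockRatio r s p k t) * μ := by
        rw [Real.sqrt_mul' _ (sq_nonneg _), Real.sqrt_sq hμ0.le]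

/-- `h1` removes shared leaves of stars with distinct centres, `h2` and `h3` remove pairs with a
common centre, and `h4` removes identical stars and the null variance. -/
theorem tendsto_blockRatio {r s p k : ℕ → ℝ} {t : ℕ} (hk : Tendsto k atTop atTop)
    (h1 : Tendsto (fun n => s n * p n) atTop atTop)
    (h2 : Tendsto (fun n => r n * p n) atTop atTop)
    (h3 : Tendsto (fun n => s n * p n ^ 2) atTop atTop)
    (h4 : Tendsto (fun n => r n * p n ^ 2 * (s n * p n ^ 2) ^ t) atTop atTop) :
    Tendsto (fun n => blockRatio (r n) (s n) (p n) (k n) t) atTop (nhds 0) := by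
  have inv : ∀ {g : ℕ → ℝ}, Tendsto g atTop atTop → Tendsto (fun n => 1 / g n) atTop (nhds 0) :=
    fun h => by simpa only [one_div] using! h.inv_tendsto_atTop
  have hθ : Tendsto (fun n => ((1 - ((t + 1 : ℕ) : ℝ) / k n) ^ (t + 1)) ^ 2) atTop (nhds 1) := by
    have := (((hk.const_div_atTop ((t + 1 : ℕ) : ℝ)).const_sub 1).pow (t + 1)).pow 2
    simpa only [sub_zero, one_pow] using this
  have hZ : Tendsto (fun n => blockMoment (r n) (s n) (p n) t) atTop (nhds 1) := by
    have := (((inv h1).const_add 1).pow t).add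
      (((inv h2).mul (((inv h3).const_add 1).pow t)).add (inv h4))
    simpa only [add_zero, one_pow, zero_mul, blockMoment] using this
  have := (((hZ.div hθ one_ne_zero).sub_const 1)).max ((inv h4).div hθ one_ne_zero)
  simpa only [div_one, sub_self, zero_div, max_self, blockRatio, Pi.div_apply] using this

/-! ### Powers of n and the dimensions of the rectangle -/

theorem tendsto_atTop_of_rpow_le {g : ℕ → ℝ} {c a : ℝ} (hc : 0 < c) (ha : 0 < a)
    (h : ∀ᶠ n : ℕ in atTop, c * (n : ℝ) ^ a ≤ g n) : Tendsto g atTop atTop :=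
  tendsto_atTop_mono' _ h
    (((tendsto_rpow_atTop ha).comp tendsto_natCast_atTop_atTop).const_mul_atTop hc)

theorem eventually_le_div_of_isBigO {k : ℕ → ℕ} {δ : ℝ}
    (hk : (fun n : ℕ => (n : ℝ) ^ (1 / 2 + δ)) =O[atTop] fun n => (k n : ℝ)) :
    ∃ c > 0, ∀ᶠ n : ℕ in atTop, c * (n : ℝ) ^ (1 / 2 + δ) ≤ k n ∧
      c * (n : ℝ) ^ (-(1 / 2 - δ)) ≤ (k n : ℝ) / n := by
  obtain ⟨C, hC, h⟩ := hk.exists_pos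
  refine ⟨C⁻¹, inv_pos.2 hC, ?_⟩
  filter_upwards [h.bound, eventually_gt_atTop 0] with n hn hn0
  have hn0' : (0 : ℝ) < n := by exact_mod_cast hn0
  rw [Real.norm_of_nonneg (by positivity), Real.norm_of_nonneg (by positivity)] at hn
  have h1 : C⁻¹ * (n : ℝ) ^ (1 / 2 + δ) ≤ k n := by rwa [inv_mul_le_iff₀ hC]
  refine ⟨h1, ?_⟩
  rwa [le_div_iff₀ hn0', mul_assoc, ← Real.rpow_add_one hn0'.ne',
    show -(1 / 2 - δ) + 1 = 1 / 2 + δ by ring]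

theorem natCeil_rpow_le {n : ℕ} (hn : 0 < n) {a : ℝ} (ha : 0 ≤ a) :
    (⌈(n : ℝ) ^ a⌉₊ : ℝ) ≤ 2 * (n : ℝ) ^ a := by
  have h1 : (1 : ℝ) ≤ (n : ℝ) ^ a := Real.one_le_rpow (by exact_mod_cast hn) ha
  linarith [Nat.ceil_lt_add_one (zero_le_one.trans h1)]

theorem stronglySeparates_of_ratio {ι : ℕ → Type} {P Q : ∀ n, Measure (ι n → ℝ)}
    {f : ∀ n, MvPolynomial (ι n) ℝ} {κ : ℕ → ℝ} (hκ : Tendsto κ atTop (nhds 0))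
    (h : ∀ᶠ n in atTop, 0 < meanGap (P n) (Q n) (f n) ∧
      maxStd (P n) (Q n) (f n) ≤ √(κ n) * meanGap (P n) (Q n) (f n)) :
    StronglySeparates P Q f := by
  refine ⟨h.mono fun n hn => hn.1.ne', isLittleO_iff.2 fun c hc => ?_⟩
  have hκ' : Tendsto (fun n => √(κ n)) atTop (nhds 0) := by simpa using hκ.sqrt
  filter_upwards [h, hκ'.eventually_le_const hc] with n h1 h2
  have hs : 0 ≤ maxStd (P n) (Q n) (f n) := Real.sqrt_nonneg _
  rw [Real.norm_of_nonneg hs, Real.norm_of_nonneg h1.1.le]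
  exact h1.2.trans (mul_le_mul_of_nonneg_right h2 h1.1.le)

theorem exists_rectMask_stronglySeparates {δ γ : ℝ} (hδ₀ : 0 < δ) (hδ₁ : δ < 1 / 2)
    (hγ : 3 * (1 / 2 - δ) < γ) : ∃ C : ℕ,
      ∀ k : ℕ → ℕ, (fun n => (k n : ℝ)) =Θ[atTop] (fun n : ℕ => (n : ℝ) ^ (1 / 2 + δ)) →
      ∃ (A B : ∀ n, Finset (Fin n)) (f : ∀ n, MvPolynomial (rectMask (A n) (B n)) ℝ),
        (∀ n, Disjoint (A n) (B n)) ∧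
        (fun n => ((rectMask (A n) (B n)).card : ℝ)) =O[atTop] (fun n : ℕ => (n : ℝ) ^ γ) ∧
        (∀ n, (f n).totalDegree ≤ C) ∧
        StronglySeparates (fun n => maskedPlanted (k n) (rectMask (A n) (B n)))
          (fun n => maskedNull (rectMask (A n) (B n))) f := by
  obtain ⟨ε, rfl⟩ : ∃ ε, δ = 1 / 2 - ε := ⟨1 / 2 - δ, by ring⟩
  rw [show 1 / 2 - (1 / 2 - ε) = ε by ring] at hγ
  have hε0 : 0 < ε := by linarith
  have hε1 : ε < 1 / 2 := by linarith
  -- The first bound keeps the area rts within O(n^γ); the second lets the sides fit into [n] for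
  -- large n.
  obtain ⟨η, hη0, hη1, hη2⟩ : ∃ η > 0, 3 * ε + 2 * η ≤ γ ∧ 2 * ε + η < 1 := by
    refine ⟨min ((γ - 3 * ε) / 2) ((1 - 2 * ε) / 2), lt_min (by linarith) (by linarith), ?_, ?_⟩
    · linarith [min_le_left ((γ - 3 * ε) / 2) ((1 - 2 * ε) / 2)]
    · linarith [min_le_right ((γ - 3 * ε) / 2) ((1 - 2 * ε) / 2)]
  -- rp² may be as small as n^(η-ε) up to a constant; t blocks, each gaining n^η, make up for it.
  -- The choice depends only on γ and δ, and t bounds the degree.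
  obtain ⟨t, ht⟩ := exists_nat_ge (ε / η)
  have ht0 : 0 < t := by
    have : (0 : ℝ) < t := (div_pos hε0 hη0).trans_le ht
    exact_mod_cast this
  have htη : ε ≤ t * η := (div_le_iff₀ hη0).1 ht
  refine ⟨t, fun k hk => ?_⟩
  obtain ⟨c, hc0, hc⟩ := eventually_le_div_of_isBigO hk.2
  rw [show 1 / 2 - (1 / 2 - ε) = ε by ring] at hc
  have hkn := eventually_le_of_isBigO hδ₁ hk.1
  have hktop : Tendsto (fun n => (k n : ℝ)) atTop atTop :=
    tendsto_atTop_of_rpow_le hc0 (a := 1 / 2 + (1 / 2 - ε)) (by linarith) (hc.mono fun n h => h.1)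
  set r : ℕ → ℕ := fun n => ⌈(n : ℝ) ^ (ε + η)⌉₊
  set s : ℕ → ℕ := fun n => ⌈(n : ℝ) ^ (2 * ε + η)⌉₊
  have hlow : ∀ᶠ n : ℕ in atTop, c * (n : ℝ) ^ (ε + η) ≤ s n * ((k n : ℝ) / n) ∧
      c * (n : ℝ) ^ η ≤ r n * ((k n : ℝ) / n) ∧
      c ^ 2 * (n : ℝ) ^ η ≤ s n * ((k n : ℝ) / n) ^ 2 ∧
      c ^ 2 * (n : ℝ) ^ (η - ε) ≤ r n * ((k n : ℝ) / n) ^ 2 := by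
    filter_upwards [hc, eventually_gt_atTop 0] with n hn h0
    have hn0 : (0 : ℝ) < n := by exact_mod_cast h0
    have hr : (n : ℝ) ^ (ε + η) ≤ r n := Nat.le_ceil _
    have hs : (n : ℝ) ^ (2 * ε + η) ≤ s n := Nat.le_ceil _
    have hp := hn.2
    refine ⟨?_, ?_, ?_, ?_⟩
    · calc c * (n : ℝ) ^ (ε + η) = (n : ℝ) ^ (2 * ε + η) * (c * (n : ℝ) ^ (-ε)) := by
            rw [mul_left_comm, ← Real.rpow_add hn0]; ring_nf
        _ ≤ _ := by gcongr
    · calc c * (n : ℝ) ^ η = (n : ℝ) ^ (ε + η) * (c * (n : ℝ) ^ (-ε)) := by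
            rw [mul_left_comm, ← Real.rpow_add hn0]; ring_nf
        _ ≤ _ := by gcongr
    · calc c ^ 2 * (n : ℝ) ^ η = (n : ℝ) ^ (2 * ε + η) * (c * (n : ℝ) ^ (-ε)) ^ 2 := by
            rw [mul_pow, mul_left_comm, sq ((n : ℝ) ^ (-ε)), ← Real.rpow_add hn0,
              ← Real.rpow_add hn0]
            ring_nf
        _ ≤ _ := by gcongr
    · calc c ^ 2 * (n : ℝ) ^ (η - ε) = (n : ℝ) ^ (ε + η) * (c * (n : ℝ) ^ (-ε)) ^ 2 := by
            rw [mul_pow, mul_left_comm, sq ((n : ℝ) ^ (-ε)), ← Real.rpow_add hn0,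
              ← Real.rpow_add hn0]
            ring_nf
        _ ≤ _ := by gcongr
  have hratio := tendsto_blockRatio (r := fun n => r n) (s := fun n => s n)
    (p := fun n => (k n : ℝ) / n) (t := t) hktop
    (tendsto_atTop_of_rpow_le hc0 (by linarith) (hlow.mono fun n h => h.1))
    (tendsto_atTop_of_rpow_le hc0 hη0 (hlow.mono fun n h => h.2.1))
    (tendsto_atTop_of_rpow_le (pow_pos hc0 2) hη0 (hlow.mono fun n h => h.2.2.1))
    (by
      refine tendsto_atTop_of_rpow_le (c := c ^ 2 * (c ^ 2) ^ t) (a := η - ε + η * t)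
        (by positivity) (by linarith) ?_
      filter_upwards [hlow, eventually_gt_atTop 0] with n hn h0
      have hn0 : (0 : ℝ) < n := by exact_mod_cast h0
      calc _ = c ^ 2 * (n : ℝ) ^ (η - ε) * (c ^ 2 * (n : ℝ) ^ η) ^ t := by
            rw [Real.rpow_add hn0, Real.rpow_mul_natCast hn0.le]
            ring
        _ ≤ _ := mul_le_mul hn.2.2.2 (pow_le_pow_left₀ (by positivity) hn.2.2.1 t)
            (by positivity) (by positivity))
  have hfit : ∀ᶠ n : ℕ in atTop, r n + t * s n ≤ n := by
    have h1 := tendsto_const_mul_natCast_rpow_neg (2 * (1 + t)) (a := 2 * ε + η - 1) (by linarith)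
    filter_upwards [h1.eventually_le_const one_pos, eventually_gt_atTop 0] with n hn h0
    have hn0 : (0 : ℝ) < n := by exact_mod_cast h0
    have hn1 : (1 : ℝ) ≤ n := by exact_mod_cast h0
    have hr : (r n : ℝ) ≤ 2 * (n : ℝ) ^ (2 * ε + η) :=
      (natCeil_rpow_le h0 (by linarith)).trans
        (mul_le_mul_of_nonneg_left (Real.rpow_le_rpow_of_exponent_le hn1 (by linarith)) (by simp))
    have hs : (s n : ℝ) ≤ 2 * (n : ℝ) ^ (2 * ε + η) := natCeil_rpow_le h0 (by linarith)
    have h2 : (r n : ℝ) + t * s n ≤ n := by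
      calc (r n : ℝ) + t * s n ≤ 2 * (n : ℝ) ^ (2 * ε + η) + t * (2 * (n : ℝ) ^ (2 * ε + η)) := by
            gcongr
        _ = 2 * (1 + t) * (n : ℝ) ^ (2 * ε + η - 1) * n := by
            rw [Real.rpow_sub_one hn0.ne']
            field_simp
        _ ≤ 1 * n := by gcongr
        _ = n := one_mul _
    exact_mod_cast h2
  have hex : ∀ n, ∃ (A B : Finset (Fin n)) (f : MvPolynomial (rectMask A B) ℝ),
      Disjoint A B ∧ f.totalDegree ≤ t ∧ (rectMask A B).card ≤ r n * (t * s n) ∧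
      (r n + t * s n ≤ n → 0 < n → k n ≤ n → t + 1 < k n →
        0 < meanGap (maskedPlanted (k n) (rectMask A B)) (maskedNull (rectMask A B)) f ∧
        maxStd (maskedPlanted (k n) (rectMask A B)) (maskedNull (rectMask A B)) f ≤
          √(blockRatio (r n) (s n) (k n / n) (k n) t) *
          meanGap (maskedPlanted (k n) (rectMask A B)) (maskedNull (rectMask A B)) f) := by
    intro n
    by_cases h : r n + t * s n ≤ n
    · obtain ⟨φ⟩ : Nonempty (Fin (r n) ⊕ (Fin t × Fin (s n)) ↪ Fin n) :=
        Function.Embedding.nonempty_of_card_le (by simpa using h)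
      refine ⟨blockLeft φ, blockRight φ, blockPoly φ, disjoint_blockLeft_blockRight φ,
        totalDegree_blockPoly_le φ, ?_, fun _ h0 hk hkt => ?_⟩
      · refine (card_rectMask_le _ _).trans (le_of_eq ?_)
        simp [blockLeft, blockRight]
      · have hn0 : (0 : ℝ) < n := by exact_mod_cast h0
        exact separation_blockPoly φ ht0 (Nat.ceil_pos.2 (by positivity))
          (Nat.ceil_pos.2 (by positivity)) hk hkt
    -- Disjointness and the degree bound are required for every n, so when the rectangle does not
    -- fit an empty mask and the zero polynomial are used.
    · refine ⟨∅, ∅, 0, by simp, by simp, ?_, fun h' => absurd h' h⟩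
      exact (card_rectMask_le _ _).trans (by simp)
  choose A B f hdisj hdeg hcard hsep using hex
  refine ⟨A, B, f, hdisj, ?_, hdeg, ?_⟩
  · refine IsBigO.of_bound (4 * t) ?_
    filter_upwards [eventually_gt_atTop 0] with n h0
    have hn0 : (0 : ℝ) < n := by exact_mod_cast h0
    have hn1 : (1 : ℝ) ≤ n := by exact_mod_cast h0
    rw [Real.norm_of_nonneg (Nat.cast_nonneg _), Real.norm_of_nonneg (by positivity)]
    have hr : (r n : ℝ) ≤ 2 * (n : ℝ) ^ (ε + η) := natCeil_rpow_le h0 (by linarith)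
    have hs : (s n : ℝ) ≤ 2 * (n : ℝ) ^ (2 * ε + η) := natCeil_rpow_le h0 (by linarith)
    calc ((rectMask (A n) (B n)).card : ℝ) ≤ r n * (t * s n) := by exact_mod_cast hcard n
      _ ≤ (2 * (n : ℝ) ^ (ε + η)) * (t * (2 * (n : ℝ) ^ (2 * ε + η))) := by gcongr
      _ = 4 * t * (n : ℝ) ^ (3 * ε + 2 * η) := by
          rw [show 3 * ε + 2 * η = (ε + η) + (2 * ε + η) by ring, Real.rpow_add hn0 (ε + η)]
          ring
      _ ≤ _ := by gcongr
  · refine stronglySeparates_of_ratio hratio ?_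
    filter_upwards [hfit, hkn, eventually_gt_atTop 0,
      hktop.eventually_gt_atTop ((t + 1 : ℕ) : ℝ)] with n h1 h2 h3 h4
    exact hsep n h1 h3 h2 (by exact_mod_cast h4)

theorem theorem1 (δ γ : ℝ) (hδ₀ : 0 < δ) (hδ₁ : δ < 1 / 2) (hγ₀ : 0 < γ) (hγ₁ : γ < 2) :
    (γ < 3 * (1 / 2 - δ) →
      ∀ k : ℕ → ℕ, (fun n => (k n : ℝ)) =Θ[atTop] (fun n : ℕ => (n : ℝ) ^ (1 / 2 + δ)) →
      ∀ M : ∀ n, Mask n,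
        (fun n => ((M n).card : ℝ)) =O[atTop] (fun n : ℕ => (n : ℝ) ^ γ) →
      ∀ f : ∀ n, MvPolynomial (M n) ℝ,
        (fun n => ((f n).totalDegree : ℝ)) =o[atTop] (fun n : ℕ => Real.log n ^ 2) →
        ¬ WeaklySeparates (fun n => maskedPlanted (k n) (M n)) (fun n => maskedNull (M n)) f) ∧
    (3 * (1 / 2 - δ) < γ →
      ∃ C : ℕ,
      ∀ k : ℕ → ℕ, (fun n => (k n : ℝ)) =Θ[atTop] (fun n : ℕ => (n : ℝ) ^ (1 / 2 + δ)) →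
      ∃ (A B : ∀ n, Finset (Fin n)) (f : ∀ n, MvPolynomial (rectMask (A n) (B n)) ℝ),
        (∀ n, Disjoint (A n) (B n)) ∧
        (fun n => ((rectMask (A n) (B n)).card : ℝ)) =O[atTop] (fun n : ℕ => (n : ℝ) ^ γ) ∧
        (∀ n, (f n).totalDegree ≤ C) ∧
        StronglySeparates (fun n => maskedPlanted (k n) (rectMask (A n) (B n)))
          (fun n => maskedNull (rectMask (A n) (B n))) f) := by

  refine ⟨fun hγ k hk M hM f hf => ?_, fun hγ => ?_⟩
  · exact not_weaklySeparates_of_card_mask hδ₁ hγ hk.1 hM hf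
  · exact exists_rectMask_stronglySeparates hδ₀ hδ₁ hγ
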